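/- **Theorem (preservation of $\Delta$-inseparability for fluent-free $\Delta$).** *Language.* The situation calculus has the sorts action, situation and object, and the alphabet $\{do,\preceq,S_0,Poss\}\cup\mathcal A\cup\mathcal F\cup\mathcal O\cup\mathcal P$, where $do$ maps an action and a situation to a situation, $\preceq$ is a binary predicate on situations, $S_0$ is a constant of sort situation, $Poss$ is a predicate on actions and situations, $\mathcal A$ consists of functions from objects to actions, $\mathcal F$ of *fluents* (predicates with object arguments and one last argument of sort situation), $\mathcal O$ of object constants and $\mathcal P$ of static predicates and functions on objects. A *signature* is a set of these symbols; equality is logical; ${\tt sig}(\cdot)$ is the set of symbols that occur in a formula or in a set of formulas. A signature is *fluent-free* if it contains no fluent. A formula of (three-sorted, relational) second-order logic over this alphabet is *uniform* in a situation term $S$ if it has no quantifier over situation variables, no equality between situation terms, no occurrence of $Poss$ or $\preceq$, and the term in the situation argument of every fluent (and of every predicate variable that has a situation argument) is $S$. *Logic.* Let $\mathcal L$ be a set of second-order sentences over this alphabet, with Tarskian semantics (non-empty domains). A *theory in $\mathcal L$* is a subset of $\mathcal L$; $\equiv$ is semantic equivalence; ${\tt Cons}(\mathcal T,\Delta)=\{\varphi\in\mathcal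 L\mid \mathcal T\models\varphi,\ {\tt sig}(\varphi)\subseteq\Delta\}$; $\mathcal T_1,\mathcal T_2$ are *$\Delta$-inseparable* if ${\tt Cons}(\mathcal T_1,\Delta)={\tt Cons}(\mathcal T_2,\Delta)$. $\mathcal L$ has *PIP* if for all theories $\mathcal T_1,\mathcal T_2$ in $\mathcal L$ with ${\tt sig}(\mathcal T_1)\cap{\tt sig}(\mathcal T_2)=\Delta$ and every $\varphi\in\mathcal L$ with $\mathcal T_1\cup\mathcal T_2\models\varphi$ there are $\mathcal T_1',\mathcal T_2'\subseteq\mathcal L$ with $\mathcal T_i\models\mathcal T_i'$, $\mathcal T_1'\cup\mathcal T_2'\models\varphi$ and ${\tt sig}(\mathcal T_i')\setminus\Delta\subseteq({\tt sig}(\mathcal T_i)\cap{\tt sig}(\varphi))\setminus\Delta$. *PIP for countably infinite families* is the same property for sequences $(\mathcal T_k)_{k\in\mathbb N}$ with ${\tt sig}(\mathcal T_k)\cap{\tt sig}(\mathcal T_l)=\Delta$ for all $k\ne l$, and unions over all $k$. A theory $\mathcal T$ is *$\sigma$-decomposable with components* $\{D_i\}_{i\in I}$ ($I\subseteq\omega$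 with at least two elements) if the $D_i$ are theories in $\mathcal L$ with ${\tt sig}(D_i)\cap{\tt sig}(D_k)=\sigma$ for $i\neq k$, ${\tt sig}(D_i)\ne\sigma$ for all $i$, $\bigcup_i{\tt sig}(D_i)={\tt sig}(\mathcal T)$ and $\mathcal T\equiv\bigcup_iD_i$. *Basic action theory.* Let $\mathcal D=\Sigma\cup\mathcal D_{una}\cup\mathcal D_{S_0}\cup\mathcal D_{ap}\cup\mathcal D_{ss}$ be a basic action theory over a signature $\tau\supseteq\{do,\preceq,S_0,Poss\}$, that is: - $\Sigma$ consists of $\forall a_1a_2s_1s_2\,[do(a_1,s_1)=do(a_2,s_2)\to a_1=a_2\wedge s_1=s_2]$, $\forall s\,\neg(s\preceq S_0\wedge s\ne S_0)$, $\forall s_1s_2\,[s_1\preceq s_2\leftrightarrow\exists a\,(do(a,s_1)\preceq s_2)\vee s_1=s_2]$ and the induction axiom $\forall P\,\big[P(S_0)\wedge\forall a,s\,(P(s)\to P(do(a,s)))\to\forall s\,P(s)\big]$; - $\mathcal D_{una}$ consists of $c\neq d$ for distinct object constants $c,d\in\tau$, $\forall\bar x\bar y\,A(\bar x)\ne A'(\bar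 y)$ for distinct action functions $A,A'\in\tau$, and $\forall\bar x\bar y\,[A(\bar x)=A(\bar y)\to\bar x=\bar y]$ for action functions $A\in\tau$; - $\mathcal D_{S_0}$ is a set of sentences over $\tau$ uniform in $S_0$; - $\mathcal D_{ap}$ consists of one axiom $\forall\bar x,s\,(Poss(A(\bar x),s)\leftrightarrow\Pi_A(\bar x,s))$ for each action function $A\in\tau$, with $\Pi_A$ a first-order formula over $\tau$ uniform in $s$ with free variables among $\bar x,s$; - $\mathcal D_{ss}$ consists of one axiom $\forall\bar x,a,s\,\big(F(\bar x,do(a,s))\leftrightarrow\gamma_F^+(\bar x,a,s)\vee F(\bar x,s)\wedge\neg\gamma_F^-(\bar x,a,s)\big)$ for each fluent $F\in\tau$, where $\gamma_F^\pm$ are finite disjunctions of formulas $\exists\bar y\,(a=A(\bar t)\wedge\phi)$ with $A\in\tau$ an action function, $\bar t$ object terms over $\tau$ with variables among $\bar x,\bar y$, and $\phi$ a first-order formula over $\tau$ uniform in $s$ with free variables among $\bar x,\bar y,s$. *Progression.* Let $\alpha$ be a ground action term and $S_\alpha=do(\alpha,S_0)$. For structures write $M\sim_{S_\alpha}M'$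 if $M,M'$ have the same domains of sorts action and object, interpret all symbols of $\mathcal A\cup\mathcal O\cup\mathcal P$ identically, and agree on all fluents at $S_\alpha$. A set $\mathcal D_{S_\alpha}$ of second-order sentences is a *progression* of $\mathcal D_{S_0}$ with respect to $\alpha$ if it is uniform in $S_\alpha$ and for every structure $M$: $M\models\Sigma\cup\mathcal D_{ss}\cup\mathcal D_{ap}\cup\mathcal D_{una}\cup\mathcal D_{S_\alpha}$ if and only if $M\models\Sigma\cup\mathcal D_{ss}\cup\mathcal D_{ap}\cup\mathcal D_{una}$ and $M\sim_{S_\alpha}M'$ for some model $M'$ of $\mathcal D$. $\mathcal D_{S_\alpha}(S_0/S_\alpha)$ is the result of replacing every occurrence of $S_\alpha$ by $S_0$. *Statement.* Let $\mathcal L$ have PIP, let $\mathcal D_{S_0},\mathcal D_{una}\subseteq\mathcal L$, let $\sigma\subseteq{\tt sig}(\mathcal D_{S_0})$ be fluent-free, and let $\Delta={\tt sig}(\mathcal D_{una})\cup\sigma$. Suppose: - $\mathcal D_{S_0}$ is $\sigma$-decomposable with components $\{D_i\}_{i\in I\subseteq\omega}$ such that the theories $\mathcal D_{una}\cup D_i$,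 $i\in I$, are pairwise $\Delta$-inseparable; if $I$ is infinite, $\mathcal L$ also has PIP for countably infinite families; - $\mathcal D_{S_\alpha}$ is a progression of $\mathcal D_{S_0}$ with respect to $\alpha$, and $\mathcal D_{S_\alpha}(S_0/S_\alpha)$ is equivalent to the union of theories $\{D'_j\}_{j\in J\subseteq\omega}$ in $\mathcal L$ such that for every $j\in J$ there is $i\in I$ with ${\tt Cons}(\mathcal D_{una}\cup D'_j,\Delta)\supseteq{\tt Cons}(\mathcal D_{una}\cup D_i,\Delta)$. Then the theories $\mathcal D_{una}\cup D'_j$, $j\in J$, are pairwise $\Delta$-inseparable. -/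

import Mathlib

universe u

namespace SitCalc

/-! ## Alphabet, terms and formulas of the situation calculus -/

/-- The three sorts. -/
inductive Srt where
  | act | sit | obj
  deriving DecidableEq

/-- The variable part of the alphabet: action functions, fluents, object constants, static
predicates and static functions, with their numbers of object arguments. Besides these object
arguments a fluent has one last argument of sort situation. -/
structure Alphabet where
  ActFn : Type
  Fluent : Type
  Const : Type
  SPred : Type
  SFun : Type
  actArity : ActFn → ℕ
  fluentArity : Fluent → ℕ
  predArity : SPred → ℕ
  funArity : SFun → ℕ

/-- The non-logical symbols (equality is logical). -/
inductive Symbol (A : Alphabet) where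
  | doS
  | prec
  | S0
  | poss
  | actFn (f : A.ActFn)
  | fluent (F : A.Fluent)
  | const (c : A.Const)
  | spred (P : A.SPred)
  | sfun (f : A.SFun)

inductive ObjTerm (A : Alphabet) where
  | var (n : ℕ)
  | const (c : A.Const)
  | sfun (f : A.SFun) (args : Fin (A.funArity f) → ObjTerm A)

inductive ActTerm (A : Alphabet) where
  | var (n : ℕ)
  | app (f : A.ActFn) (args : Fin (A.actArity f) → ObjTerm A)

inductive SitTerm (A : Alphabet) where
  | var (n : ℕ)
  | S0
  | doS (a : ActTerm A) (s : SitTerm A)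

/-- Terms of a given sort. -/
def Term (A : Alphabet) : Srt → Type
  | .act => ActTerm A
  | .sit => SitTerm A
  | .obj => ObjTerm A

/-- Formulas of three-sorted second-order logic with equality. `pvar τ n` is the `n`-th predicate
variable whose arguments have the sorts listed in `τ`. -/
inductive Formula (A : Alphabet) where
  | falsum
  | imp (φ ψ : Formula A)
  | eq (k : Srt) (t t' : Term A k)
  | prec (s s' : SitTerm A)
  | poss (a : ActTerm A) (s : SitTerm A)
  | fluent (F : A.Fluent) (args : Fin (A.fluentArity F) → ObjTerm A) (s : SitTerm A)
  | spred (P : A.SPred) (args : Fin (A.predArity P) → ObjTerm A)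
  | pvar (τ : List Srt) (n : ℕ) (args : ∀ i : Fin τ.length, Term A (τ.get i))
  | all (k : Srt) (n : ℕ) (φ : Formula A)
  | allP (τ : List Srt) (n : ℕ) (φ : Formula A)

/-- A set of formulas. -/
abbrev Theory (A : Alphabet) := Set (Formula A)

variable {A : Alphabet}

namespace Formula

def neg (φ : Formula A) : Formula A := imp φ falsum
def and (φ ψ : Formula A) : Formula A := neg (imp φ (neg ψ))
def or (φ ψ : Formula A) : Formula A := imp (neg φ) ψ
def iff (φ ψ : Formula A) : Formula A := and (imp φ ψ) (imp ψ φ)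
def ex (k : Srt) (n : ℕ) (φ : Formula A) : Formula A := neg (all k n (neg φ))

/-- Finite conjunction; the empty one is true. -/
def bigAnd : List (Formula A) → Formula A
  | [] => neg falsum
  | φ :: l => and φ (bigAnd l)

/-- Finite disjunction; the empty one is false. -/
def bigOr : List (Formula A) → Formula A
  | [] => falsum
  | φ :: l => or φ (bigOr l)

/-- Universal quantification over the `m` object variables with numbers `k, …, k + m - 1`. -/
def allObj (k : ℕ) : ℕ → Formula A → Formula A
  | 0, φ => φ
  | m + 1, φ => all .obj k (allObj (k + 1) m φ)

/-- Existential quantification over the `m` object variables with numbers `k, …, k + m - 1`. -/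
def exObj (k : ℕ) : ℕ → Formula A → Formula A
  | 0, φ => φ
  | m + 1, φ => ex .obj k (exObj (k + 1) m φ)

end Formula

/-! ## Variables and signatures -/

def ObjTerm.vars : ObjTerm A → Set (Srt × ℕ)
  | .var n => {(.obj, n)}
  | .const _ => ∅
  | .sfun _ args => ⋃ i, (args i).vars

def ActTerm.vars : ActTerm A → Set (Srt × ℕ)
  | .var n => {(.act, n)}
  | .app _ args => ⋃ i, (args i).vars

def SitTerm.vars : SitTerm A → Set (Srt × ℕ)
  | .var n => {(.sit, n)}
  | .S0 => ∅
  | .doS a s => a.vars ∪ s.vars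

def Term.vars : (k : Srt) → Term A k → Set (Srt × ℕ)
  | .act, t => ActTerm.vars t
  | .sit, t => SitTerm.vars t
  | .obj, t => ObjTerm.vars t

/-- Free individual variables. -/
def Formula.fv : Formula A → Set (Srt × ℕ)
  | .falsum => ∅
  | .imp φ ψ => φ.fv ∪ ψ.fv
  | .eq k t t' => Term.vars k t ∪ Term.vars k t'
  | .prec s s' => s.vars ∪ s'.vars
  | .poss a s => a.vars ∪ s.vars
  | .fluent _ args s => (⋃ i, (args i).vars) ∪ s.vars
  | .spred _ args => ⋃ i, (args i).vars
  | .pvar τ _ args => ⋃ i, Term.vars (τ.get i) (args i)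
  | .all k n φ => φ.fv \ {(k, n)}
  | .allP _ _ φ => φ.fv

/-- Free predicate variables. -/
def Formula.pfv : Formula A → Set (List Srt × ℕ)
  | .imp φ ψ => φ.pfv ∪ ψ.pfv
  | .pvar τ n _ => {(τ, n)}
  | .all _ _ φ => φ.pfv
  | .allP τ n φ => φ.pfv \ {(τ, n)}
  | _ => ∅

/-- No free variables of either kind. -/
def Formula.IsSentence (φ : Formula A) : Prop := φ.fv = ∅ ∧ φ.pfv = ∅

/-- No predicate variables, free or bound. -/
def Formula.IsFirstOrder : Formula A → Prop
  | .imp φ ψ => φ.IsFirstOrder ∧ ψ.IsFirstOrder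
  | .pvar _ _ _ => False
  | .all _ _ φ => φ.IsFirstOrder
  | .allP _ _ _ => False
  | _ => True

def ObjTerm.sig : ObjTerm A → Set (Symbol A)
  | .var _ => ∅
  | .const c => {.const c}
  | .sfun f args => {.sfun f} ∪ ⋃ i, (args i).sig

def ActTerm.sig : ActTerm A → Set (Symbol A)
  | .var _ => ∅
  | .app f args => {.actFn f} ∪ ⋃ i, (args i).sig

def SitTerm.sig : SitTerm A → Set (Symbol A)
  | .var _ => ∅
  | .S0 => {.S0}
  | .doS a s => {.doS} ∪ a.sig ∪ s.sig

def Term.sig : (k : Srt) → Term A k → Set (Symbol A)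
  | .act, t => ActTerm.sig t
  | .sit, t => SitTerm.sig t
  | .obj, t => ObjTerm.sig t

/-- The non-logical symbols that occur in a formula. -/
def Formula.sig : Formula A → Set (Symbol A)
  | .falsum => ∅
  | .imp φ ψ => φ.sig ∪ ψ.sig
  | .eq k t t' => Term.sig k t ∪ Term.sig k t'
  | .prec s s' => {.prec} ∪ s.sig ∪ s'.sig
  | .poss a s => {.poss} ∪ a.sig ∪ s.sig
  | .fluent F args s => {.fluent F} ∪ (⋃ i, (args i).sig) ∪ s.sig
  | .spred P args => {.spred P} ∪ ⋃ i, (args i).sig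
  | .pvar τ _ args => ⋃ i, Term.sig (τ.get i) (args i)
  | .all _ _ φ => φ.sig
  | .allP _ _ φ => φ.sig

/-- The signature of a theory. -/
def sig (T : Theory A) : Set (Symbol A) := ⋃ φ ∈ T, φ.sig

/-- A signature that contains no fluent. -/
def FluentFree (Δ : Set (Symbol A)) : Prop := ∀ F : A.Fluent, Symbol.fluent F ∉ Δ

/-! ## Uniform formulas and replacement of situation terms -/

/-- A term of sort situation has to be the term `S`; no condition on terms of other sorts. -/
def Term.SitIs (S : SitTerm A) : (k : Srt) → Term A k → Prop
  | .act, _ => True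
  | .sit, t => t = S
  | .obj, _ => True

/-- `φ` is uniform in the situation term `S`: no quantifier over situation variables, no equality
between situation terms, no occurrence of `Poss` or of the order on situations, and `S` is the only
term in the situation argument of a fluent (and of a predicate variable, if it has any). -/
def Formula.Uniform (S : SitTerm A) : Formula A → Prop
  | .falsum => True
  | .imp φ ψ => φ.Uniform S ∧ ψ.Uniform S
  | .eq k _ _ => k ≠ .sit
  | .prec _ _ => False
  | .poss _ _ => False
  | .fluent _ _ s => s = S
  | .spred _ _ => True
  | .pvar τ _ args => ∀ i, Term.SitIs S (τ.get i) (args i)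
  | .all k _ φ => k ≠ .sit ∧ φ.Uniform S
  | .allP _ _ φ => φ.Uniform S

open Classical in
/-- Replace every occurrence of `S` by `S'` in a situation term. -/
noncomputable def SitTerm.replace (S S' : SitTerm A) : SitTerm A → SitTerm A
  | .var n => if .var n = S then S' else .var n
  | .S0 => if .S0 = S then S' else .S0
  | .doS a s => if .doS a s = S then S' else .doS a (SitTerm.replace S S' s)

/-- Terms of sort action and object have no situation subterms. -/
noncomputable def Term.replace (S S' : SitTerm A) : (k : Srt) → Term A k → Term A k
  | .act, t => t
  | .sit, t => SitTerm.replace S S' t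
  | .obj, t => t

/-- Replace every occurrence of the (ground) term `S` by the (ground) term `S'` in a formula. -/
noncomputable def Formula.replace (S S' : SitTerm A) : Formula A → Formula A
  | .falsum => .falsum
  | .imp φ ψ => .imp (φ.replace S S') (ψ.replace S S')
  | .eq k t t' => .eq k (Term.replace S S' k t) (Term.replace S S' k t')
  | .prec s s' => .prec (SitTerm.replace S S' s) (SitTerm.replace S S' s')
  | .poss a s => .poss a (SitTerm.replace S S' s)
  | .fluent F args s => .fluent F args (SitTerm.replace S S' s)
  | .spred P args => .spred P args
  | .pvar τ n args => .pvar τ n (fun i => Term.replace S S' (τ.get i) (args i))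
  | .all k n φ => .all k n (φ.replace S S')
  | .allP τ n φ => .allP τ n (φ.replace S S')

/-- The theory `T(S'/S)`: every occurrence of `S` in `T` is replaced by `S'`. -/
noncomputable def replaceTheory (T : Theory A) (S' S : SitTerm A) : Theory A :=
  Formula.replace S S' '' T

/-! ## Semantics -/

/-- The domain of each sort. -/
def Dom (Act Sit Obj : Type u) : Srt → Type u
  | .act => Act
  | .sit => Sit
  | .obj => Obj

/-- A structure on given domains for the three sorts. -/
structure Str (A : Alphabet) (Act Sit Obj : Type u) where
  doS : Act → Sit → Sit
  S0 : Sit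
  prec : Sit → Sit → Prop
  poss : Act → Sit → Prop
  actFn : (f : A.ActFn) → (Fin (A.actArity f) → Obj) → Act
  fluent : (F : A.Fluent) → (Fin (A.fluentArity F) → Obj) → Sit → Prop
  const : A.Const → Obj
  spred : (P : A.SPred) → (Fin (A.predArity P) → Obj) → Prop
  sfun : (f : A.SFun) → (Fin (A.funArity f) → Obj) → Obj

/-- Assignments of values to individual variables and to predicate variables. -/
structure Asg (Act Sit Obj : Type u) where
  ind : (k : Srt) → ℕ → Dom Act Sit Obj k
  pred : (τ : List Srt) → ℕ → (∀ i : Fin τ.length, Dom Act Sit Obj (τ.get i)) → Prop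

section Semantics

variable {Act Sit Obj : Type u}

def Asg.setInd (v : Asg Act Sit Obj) (k : Srt) (n : ℕ) (d : Dom Act Sit Obj k) :
    Asg Act Sit Obj :=
  { v with ind := Function.update v.ind k (Function.update (v.ind k) n d) }

def Asg.setPred (v : Asg Act Sit Obj) (τ : List Srt) (n : ℕ)
    (R : (∀ i : Fin τ.length, Dom Act Sit Obj (τ.get i)) → Prop) : Asg Act Sit Obj :=
  { v with pred := Function.update v.pred τ (Function.update (v.pred τ) n R) }

def ObjTerm.eval (M : Str A Act Sit Obj) (v : Asg Act Sit Obj) : ObjTerm A → Obj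
  | .var n => v.ind .obj n
  | .const c => M.const c
  | .sfun f args => M.sfun f (fun i => (args i).eval M v)

def ActTerm.eval (M : Str A Act Sit Obj) (v : Asg Act Sit Obj) : ActTerm A → Act
  | .var n => v.ind .act n
  | .app f args => M.actFn f (fun i => (args i).eval M v)

def SitTerm.eval (M : Str A Act Sit Obj) (v : Asg Act Sit Obj) : SitTerm A → Sit
  | .var n => v.ind .sit n
  | .S0 => M.S0
  | .doS a s => M.doS (a.eval M v) (s.eval M v)

def Term.eval (M : Str A Act Sit Obj) (v : Asg Act Sit Obj) :
    (k : Srt) → Term A k → Dom Act Sit Obj k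
  | .act, t => ActTerm.eval M v t
  | .sit, t => SitTerm.eval M v t
  | .obj, t => ObjTerm.eval M v t

/-- Tarskian satisfaction; predicate variables range over all relations on the domains. -/
def Sat (M : Str A Act Sit Obj) : Asg Act Sit Obj → Formula A → Prop
  | _, .falsum => False
  | v, .imp φ ψ => Sat M v φ → Sat M v ψ
  | v, .eq k t t' => Term.eval M v k t = Term.eval M v k t'
  | v, .prec s s' => M.prec (s.eval M v) (s'.eval M v)
  | v, .poss a s => M.poss (a.eval M v) (s.eval M v)
  | v, .fluent F args s => M.fluent F (fun i => (args i).eval M v) (s.eval M v)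
  | v, .spred P args => M.spred P (fun i => (args i).eval M v)
  | v, .pvar τ n args => v.pred τ n (fun i => Term.eval M v (τ.get i) (args i))
  | v, .all k n φ => ∀ d : Dom Act Sit Obj k, Sat M (v.setInd k n d) φ
  | v, .allP τ n φ =>
      ∀ R : (∀ i : Fin τ.length, Dom Act Sit Obj (τ.get i)) → Prop, Sat M (v.setPred τ n R) φ

/-- `M` is a model of `T`. -/
def Models (M : Str A Act Sit Obj) (T : Theory A) : Prop :=
  ∀ φ ∈ T, ∀ v : Asg Act Sit Obj, Sat M v φ

end Semantics

/-- Semantic consequence, over structures with non-empty domains. -/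
def Entails (T : Theory A) (φ : Formula A) : Prop :=
  ∀ (Act Sit Obj : Type u) [Nonempty Act] [Nonempty Sit] [Nonempty Obj]
    (M : Str A Act Sit Obj), Models M T → ∀ v : Asg Act Sit Obj, Sat M v φ

/-- Semantic equivalence of theories. -/
def Equivalent (T T' : Theory A) : Prop :=
  ∀ (Act Sit Obj : Type u) [Nonempty Act] [Nonempty Sit] [Nonempty Obj]
    (M : Str A Act Sit Obj), Models M T ↔ Models M T'

/-! ## Component properties of theories in a logic `L` (a set of sentences) -/

/-- The consequences of `T` in the logic `L` and the signature `Δ`. -/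
def Cons (L T : Theory A) (Δ : Set (Symbol A)) : Theory A :=
  {φ | φ ∈ L ∧ Entails.{u} T φ ∧ φ.sig ⊆ Δ}

/-- `Δ`-inseparability of two theories with respect to `L`. -/
def Inseparable (L : Theory A) (Δ : Set (Symbol A)) (T₁ T₂ : Theory A) : Prop :=
  Cons.{u} L T₁ Δ = Cons.{u} L T₂ Δ

/-- The parallel interpolation property. -/
def HasPIP (L : Theory A) : Prop :=
  ∀ (Δ : Set (Symbol A)) (T₁ T₂ : Theory A) (φ : Formula A),
    T₁ ⊆ L → T₂ ⊆ L → φ ∈ L → sig T₁ ∩ sig T₂ = Δ → Entails.{u} (T₁ ∪ T₂) φ →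
    ∃ T₁' T₂' : Theory A, T₁' ⊆ L ∧ T₂' ⊆ L ∧
      (∀ ψ ∈ T₁', Entails.{u} T₁ ψ) ∧ (∀ ψ ∈ T₂', Entails.{u} T₂ ψ) ∧
      Entails.{u} (T₁' ∪ T₂') φ ∧
      sig T₁' \ Δ ⊆ (sig T₁ ∩ φ.sig) \ Δ ∧ sig T₂' \ Δ ⊆ (sig T₂ ∩ φ.sig) \ Δ

/-- The parallel interpolation property for countably infinite families in place of pairs. -/
def HasCountablePIP (L : Theory A) : Prop :=
  ∀ (Δ : Set (Symbol A)) (T : ℕ → Theory A) (φ : Formula A),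
    (∀ k, T k ⊆ L) → φ ∈ L → (∀ k l, k ≠ l → sig (T k) ∩ sig (T l) = Δ) →
    Entails.{u} (⋃ k, T k) φ →
    ∃ T' : ℕ → Theory A, (∀ k, T' k ⊆ L) ∧ (∀ k, ∀ ψ ∈ T' k, Entails.{u} (T k) ψ) ∧
      Entails.{u} (⋃ k, T' k) φ ∧
      ∀ k, sig (T' k) \ Δ ⊆ (sig (T k) ∩ φ.sig) \ Δ

/-- The theories `D i`, `i ∈ I`, in `L` are the components of a `Δ`-decomposition of `T`;
there are at least two of them. -/
structure IsDecomposition (L : Theory A) (Δ : Set (Symbol A)) (T : Theory A)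
    {I : Set ℕ} (D : I → Theory A) : Prop where
  nontrivial : I.Nontrivial
  subset_logic : ∀ i, D i ⊆ L
  sig_inter : ∀ i k, i ≠ k → sig (D i) ∩ sig (D k) = Δ
  sig_ne : ∀ i, sig (D i) ≠ Δ
  sig_union : ⋃ i, sig (D i) = sig T
  equivalent : Equivalent.{u} T (⋃ i, D i)

/-! ## Basic action theories -/

section Axioms

open Formula

/-- The `i`-th object variable. -/
def ov (i : ℕ) : ObjTerm A := .var i

/-- The foundational axioms: injectivity of `do`, nothing strictly precedes `S0`, the recursive
characterization of the order, and second-order induction over situations. -/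
def foundational (A : Alphabet) : Theory A :=
  { all .act 0 <| all .act 1 <| all .sit 0 <| all .sit 1 <|
      imp (eq .sit (SitTerm.doS (.var 0) (.var 0)) (SitTerm.doS (.var 1) (.var 1)))
        (and (eq .act (ActTerm.var 0) (ActTerm.var 1)) (eq .sit (SitTerm.var 0) (SitTerm.var 1))),
    all .sit 0 <| neg <|
      and (prec (.var 0) .S0) (neg (eq .sit (SitTerm.var 0) SitTerm.S0)),
    all .sit 0 <| all .sit 1 <|
      iff (prec (.var 0) (.var 1))
        (or (ex .act 0 (prec (.doS (.var 0) (.var 0)) (.var 1)))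
          (eq .sit (SitTerm.var 0) (SitTerm.var 1))),
    allP [.sit] 0 <|
      imp
        (and (pvar [.sit] 0 (fun | ⟨0, _⟩ => SitTerm.S0))
          (all .act 0 <| all .sit 0 <|
            imp (pvar [.sit] 0 (fun | ⟨0, _⟩ => SitTerm.var 0))
              (pvar [.sit] 0 (fun | ⟨0, _⟩ => SitTerm.doS (.var 0) (.var 0)))))
        (all .sit 0 (pvar [.sit] 0 (fun | ⟨0, _⟩ => SitTerm.var 0))) }

/-- `c ≠ d`. -/
def unaConst (c d : A.Const) : Formula A := neg (eq .obj (ObjTerm.const c) (ObjTerm.const d))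

/-- `∀ x̄ ȳ, f(x̄) ≠ g(ȳ)`. -/
def unaAct (f g : A.ActFn) : Formula A :=
  allObj 0 (A.actArity f + A.actArity g) <|
    neg (eq .act (ActTerm.app f (fun i => ov i)) (ActTerm.app g (fun i => ov (A.actArity f + i))))

/-- `∀ x̄ ȳ, f(x̄) = f(ȳ) → x₁ = y₁ ∧ … ∧ xₙ = yₙ`. -/
def unaInj (f : A.ActFn) : Formula A :=
  allObj 0 (A.actArity f + A.actArity f) <|
    imp (eq .act (ActTerm.app f (fun i => ov i)) (ActTerm.app f (fun i => ov (A.actArity f + i))))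
      (bigAnd (List.ofFn (fun i : Fin (A.actArity f) =>
        eq .obj (ov i : ObjTerm A) (ov (A.actArity f + i) : ObjTerm A))))

/-- One disjunct `∃ ȳ (a = f(t̄) ∧ φ)` of an effect condition, with `m` variables `ȳ`. -/
structure Effect (A : Alphabet) where
  m : ℕ
  f : A.ActFn
  args : Fin (A.actArity f) → ObjTerm A
  ctx : Formula A

/-- The disjunct as a formula. For a fluent with `n` object arguments the variables `x̄` are the
object variables `0, …, n - 1`, the variables `ȳ` are the object variables `n, …, n + m - 1`, and `a`
and `s` are the action and the situation variable number `0`. -/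
def Effect.toFormula (n : ℕ) (e : Effect A) : Formula A :=
  exObj n e.m (and (eq .act (ActTerm.var 0) (ActTerm.app e.f e.args)) e.ctx)

/-- The disjunct is well-formed over the signature `σ`: `t̄` has variables among `x̄, ȳ`, and the
context condition is a first-order formula, uniform in `s`, with variables among `x̄, ȳ, s`. -/
structure Effect.WellFormed (σ : Set (Symbol A)) (n : ℕ) (e : Effect A) : Prop where
  f_mem : Symbol.actFn e.f ∈ σ
  args_vars : ∀ i, (e.args i).vars ⊆ {p | p.1 = .obj ∧ p.2 < n + e.m}
  args_sig : ∀ i, (e.args i).sig ⊆ σ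
  ctx_firstOrder : e.ctx.IsFirstOrder
  ctx_uniform : e.ctx.Uniform (.var 0)
  ctx_fv : e.ctx.fv ⊆ {p | p.1 = .obj ∧ p.2 < n + e.m} ∪ {(.sit, 0)}
  ctx_sig : e.ctx.sig ⊆ σ

/-- A basic action theory over a signature: the initial theory, the right-hand side `pre f` of the
precondition axiom of each action function `f` of the signature, and the disjuncts `pos F` and
`neg F` of the two effect conditions in the successor state axiom of each fluent `F` of the
signature. The remaining axioms are determined by the signature. -/
structure BAT (A : Alphabet) where
  signature : Set (Symbol A)
  core_mem : {.doS, .prec, .S0, .poss} ⊆ signature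
  init : Theory A
  init_sentence : ∀ φ ∈ init, φ.IsSentence
  init_uniform : ∀ φ ∈ init, φ.Uniform .S0
  init_sig : sig init ⊆ signature
  pre : A.ActFn → Formula A
  pre_firstOrder : ∀ f, .actFn f ∈ signature → (pre f).IsFirstOrder
  pre_uniform : ∀ f, .actFn f ∈ signature → (pre f).Uniform (.var 0)
  pre_fv : ∀ f, .actFn f ∈ signature →
    (pre f).fv ⊆ {p | p.1 = .obj ∧ p.2 < A.actArity f} ∪ {(.sit, 0)}
  pre_sig : ∀ f, .actFn f ∈ signature → (pre f).sig ⊆ signature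
  pos : A.Fluent → List (Effect A)
  neg : A.Fluent → List (Effect A)
  pos_wf : ∀ F, .fluent F ∈ signature → ∀ e ∈ pos F, e.WellFormed signature (A.fluentArity F)
  neg_wf : ∀ F, .fluent F ∈ signature → ∀ e ∈ neg F, e.WellFormed signature (A.fluentArity F)

namespace BAT

/-- The unique name axioms. -/
def una (D : BAT A) : Theory A :=
  {φ | ∃ c d, .const c ∈ D.signature ∧ .const d ∈ D.signature ∧ c ≠ d ∧ φ = unaConst c d} ∪
  {φ | ∃ f g, .actFn f ∈ D.signature ∧ .actFn g ∈ D.signature ∧ f ≠ g ∧ φ = unaAct f g} ∪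
  {φ | ∃ f, .actFn f ∈ D.signature ∧ φ = unaInj f}

/-- `∀ x̄ s, Poss(f(x̄), s) ↔ Π(x̄, s)`. -/
def apAxiom (D : BAT A) (f : A.ActFn) : Formula A :=
  allObj 0 (A.actArity f) <| all .sit 0 <|
    iff (poss (.app f (fun i => ov i)) (.var 0)) (D.pre f)

/-- `∀ x̄ a s, F(x̄, do(a, s)) ↔ γ⁺(x̄, a, s) ∨ (F(x̄, s) ∧ ¬ γ⁻(x̄, a, s))`. -/
def ssAxiom (D : BAT A) (F : A.Fluent) : Formula A :=
  allObj 0 (A.fluentArity F) <| all .act 0 <| all .sit 0 <|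
    iff (fluent F (fun i => ov i) (.doS (.var 0) (.var 0)))
      (or (bigOr ((D.pos F).map (Effect.toFormula (A.fluentArity F))))
        (and (fluent F (fun i => ov i) (.var 0))
          (Formula.neg (bigOr ((D.neg F).map (Effect.toFormula (A.fluentArity F)))))))

/-- The precondition axioms. -/
def ap (D : BAT A) : Theory A := {φ | ∃ f, .actFn f ∈ D.signature ∧ φ = D.apAxiom f}

/-- The successor state axioms. -/
def ss (D : BAT A) : Theory A := {φ | ∃ F, .fluent F ∈ D.signature ∧ φ = D.ssAxiom F}

/-- All axioms except the initial theory. -/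
def background (D : BAT A) : Theory A := foundational A ∪ D.ss ∪ D.ap ∪ D.una

/-- All axioms of the basic action theory. -/
def axioms (D : BAT A) : Theory A := D.background ∪ D.init

end BAT

end Axioms

/-! ## Progression -/

/-- The situation term `do(α, S0)`. -/
def sitAfter (α : ActTerm A) : SitTerm A := .doS α .S0

/-- `M ∼ M'` for a ground action term `α`: the same domains for actions and objects, the same
interpretation of all situation-independent symbols, and the same fluents at `do(α, S0)`. -/
structure Sim (α : ActTerm A) {Act Sit Sit' Obj : Type u}
    (M : Str A Act Sit Obj) (M' : Str A Act Sit' Obj) : Prop where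
  actFn_eq : M.actFn = M'.actFn
  const_eq : M.const = M'.const
  spred_eq : M.spred = M'.spred
  sfun_eq : M.sfun = M'.sfun
  fluent_iff : ∀ (v : Asg Act Sit Obj) (v' : Asg Act Sit' Obj) (F : A.Fluent)
    (x : Fin (A.fluentArity F) → Obj),
    M.fluent F x ((sitAfter α).eval M v) ↔ M'.fluent F x ((sitAfter α).eval M' v')

/-- `P` is a progression of the initial theory of `D` with respect to the ground action term `α`:
a set of second-order sentences, uniform in `do(α, S0)`, whose models among the models of the
remaining axioms are exactly the structures `M` with `M ∼ M'` for some model `M'` of `D`. -/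
structure IsProgression (D : BAT A) (α : ActTerm A) (P : Theory A) : Prop where
  sentence : ∀ φ ∈ P, φ.IsSentence
  uniform : ∀ φ ∈ P, φ.Uniform (sitAfter α)
  models_iff : ∀ (Act Sit Obj : Type u) [Nonempty Act] [Nonempty Sit] [Nonempty Obj]
    (M : Str A Act Sit Obj),
    Models M (D.background ∪ P) ↔
      Models M D.background ∧
        ∃ (Sit' : Type u) (M' : Str A Act Sit' Obj), Models M' D.axioms ∧ Sim α M M'

end SitCalc

/-! It suffices to show that every `Δ`-consequence of `D.una ∪ C' j` is one of `D.una ∪ C i`, for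
all `i` and `j`. For each `j` the converse inclusion is assumed for some `i`, so `C' j` has the same
`Δ`-consequences as that `C i`, and the `C i` all agree with one another.

Let `φ` be a `Δ`-consequence of `D.una ∪ C' j`. It follows from the unique name axioms and the
progression moved back to `S0`. It is fluent-free, because `σ` and the signature of the unique name
axioms are.

Semantic part (`entails_of_progression`): `φ` already follows from `D.una ∪ D.init`. Given a model
`M` of these, keep its actions, objects and initial state and unfold the tree of finite action
sequences. The successor state axioms determine the fluents along the branches, and the precondition
axioms determine `Poss`, so `treeStr` is a model of the whole action theory and hence of its
progression. Now give the situations of `M` the state that the tree has after `α`. Uniform sentences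
see a single state, so the altered `M` satisfies the progression moved to `S0`, and therefore `φ`.
Only fluents were altered, so `φ` holds in `M` too.

Syntactic part (`mem_cons_of_isDecomposition`): `D.una ∪ D.init` is equivalent to the union of the
theories `D.una ∪ C i`, any two of which share exactly the signature `Δ`. Parallel interpolation
replaces them by interpolants over `Δ` that still entail `φ`. Each interpolant is a `Δ`-consequence
of one component and, by inseparability, of all of them; so every single component entails `φ`. -/

namespace SitCalc

/-! ## Interpolation over decompositions -/

section Interpolation

variable {A : Alphabet}

theorem sig_union (T T' : Theory A) : sig (T ∪ T') = sig T ∪ sig T' :=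
  Set.biUnion_union T T' _

theorem sig_iUnion {ι : Sort*} (T : ι → Theory A) : sig (⋃ i, T i) = ⋃ i, sig (T i) := by
  ext x
  simp only [sig, Set.mem_iUnion]
  constructor
  · rintro ⟨φ, ⟨i, hi⟩, hx⟩
    exact ⟨i, φ, hi, hx⟩
  · rintro ⟨i, φ, hi, hx⟩
    exact ⟨φ, ⟨i, hi⟩, hx⟩

theorem subset_sig {T : Theory A} {φ : Formula A} (h : φ ∈ T) : φ.sig ⊆ sig T :=
  Set.subset_biUnion_of_mem (u := fun φ : Formula A => φ.sig) h

theorem Entails.trans {T T' : Theory A} {φ : Formula A} (h : ∀ ψ ∈ T', Entails.{u} T ψ)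
    (h' : Entails.{u} T' φ) : Entails.{u} T φ :=
  fun Act Sit Obj _ _ _ M hM => h' Act Sit Obj M fun ψ hψ => h ψ hψ Act Sit Obj M hM

theorem subset_of_diff_subset_diff {X : Type*} {s t Δ : Set X} (h : s \ Δ ⊆ t \ Δ) (ht : t ⊆ Δ) :
    s ⊆ Δ := by
  intro x hx
  by_contra hΔ
  exact hΔ (ht (h ⟨hx, hΔ⟩).1)

/-- Interpolants of a formula over the shared signature `Δ` belong to `Cons`. -/
theorem interpolant_mem_cons {L T T' : Theory A} {Δ : Set (Symbol A)} {φ ψ : Formula A}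
    (hφ : φ.sig ⊆ Δ) (hL : T' ⊆ L) (hT : ∀ ψ ∈ T', Entails.{u} T ψ)
    (hsig : sig T' \ Δ ⊆ (sig T ∩ φ.sig) \ Δ) (hψ : ψ ∈ T') : ψ ∈ Cons.{u} L T Δ :=
  ⟨hL hψ, hT ψ hψ, (subset_sig hψ).trans
    (subset_of_diff_subset_diff hsig (Set.inter_subset_right.trans hφ))⟩

/-- Over finitely many components that pairwise share the signature `Δ` once `U` is added, the
`Δ`-consequences of the union are those of each inseparable component. -/
theorem mem_cons_of_finset {L U : Theory A} (hPIP : HasPIP.{u} L) (hU : U ⊆ L)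
    {σ : Set (Symbol A)} {ι : Type*} [DecidableEq ι] {C : ι → Theory A} (hC : ∀ i, C i ⊆ L)
    (hσ : ∀ i k, i ≠ k → sig (C i) ∩ sig (C k) = σ)
    (hinsep : ∀ i k, Inseparable.{u} L (sig U ∪ σ) (U ∪ C i) (U ∪ C k))
    (s : Finset ι) (hs : s.Nonempty) :
    ∀ φ ∈ L, φ.sig ⊆ sig U ∪ σ → Entails.{u} (U ∪ ⋃ i ∈ s, C i) φ →
      ∀ i, φ ∈ Cons.{u} L (U ∪ C i) (sig U ∪ σ) := by
  induction hs using Finset.Nonempty.cons_induction with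
  | singleton k =>
    intro φ hφ hsig h i
    rw [hinsep i k]
    exact ⟨hφ, by simpa using h, hsig⟩
  | cons k s hk hs ih =>
    intro φ hφ hsig h i
    have hinter : sig (U ∪ C k) ∩ sig (U ∪ ⋃ i ∈ s, C i) = sig U ∪ σ := by
      rw [sig_union, sig_union, ← Set.union_inter_distrib_left]
      congr 1
      simp only [sig_iUnion]
      -- Non-emptiness of `s` matters: `σ` lies in the signature of the union only because some
      -- component is there.
      obtain ⟨l, hl⟩ := hs
      ext x
      simp only [Set.mem_inter_iff, Set.mem_iUnion]
      constructor
      · rintro ⟨hx, m, hm, hx'⟩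
        rw [← hσ k m (by rintro rfl; exact hk hm)]
        exact ⟨hx, hx'⟩
      · intro hx
        rw [← hσ k l (by rintro rfl; exact hk hl)] at hx
        exact ⟨hx.1, l, hl, hx.2⟩
    obtain ⟨T₁, T₂, hT₁L, hT₂L, hT₁, hT₂, hent, hs₁, hs₂⟩ := hPIP _ _ _ φ
      (Set.union_subset hU (hC k))
      (Set.union_subset hU (Set.iUnion₂_subset fun i _ => hC i)) hφ hinter (by
        have : U ∪ C k ∪ (U ∪ ⋃ i ∈ s, C i) = U ∪ ⋃ i ∈ Finset.cons k s hk, C i := by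
          ext x
          simp
          tauto
        rwa [this])
    refine ⟨hφ, Entails.trans ?_ hent, hsig⟩
    rintro ψ (hψ | hψ)
    -- Interpolants from component `k` move to component `i` by inseparability.
    · have := interpolant_mem_cons hsig hT₁L hT₁ hs₁ hψ
      rw [hinsep k i] at this
      exact this.2.1
    -- Interpolants from the remaining components are `Δ`-consequences of a smaller union. The
    -- induction hypothesis is applied to them rather than to `φ`, hence the quantifier over
    -- formulas inside the induction.
    · have := interpolant_mem_cons hsig hT₂L hT₂ hs₂ hψ
      exact (ih ψ this.1 this.2.2 this.2.1 i).2.1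

/-- The analogue of `mem_cons_of_finset` for sequences of components. -/
theorem mem_cons_of_nat {L U : Theory A} (hPIP : HasCountablePIP.{u} L) (hU : U ⊆ L)
    {σ : Set (Symbol A)} {C : ℕ → Theory A} (hC : ∀ i, C i ⊆ L)
    (hσ : ∀ i k, i ≠ k → sig (C i) ∩ sig (C k) = σ)
    (hinsep : ∀ i k, Inseparable.{u} L (sig U ∪ σ) (U ∪ C i) (U ∪ C k))
    {φ : Formula A} (hφ : φ ∈ L) (hsig : φ.sig ⊆ sig U ∪ σ)
    (h : Entails.{u} (U ∪ ⋃ i, C i) φ) (i : ℕ) : φ ∈ Cons.{u} L (U ∪ C i) (sig U ∪ σ) := by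
  obtain ⟨T, hTL, hT, hent, hs⟩ := hPIP (sig U ∪ σ) (fun k => U ∪ C k) φ
    (fun k => Set.union_subset hU (hC k)) hφ
    (fun k l hkl => by
      rw [sig_union, sig_union, ← Set.union_inter_distrib_left, hσ k l hkl])
    (by rwa [← Set.union_iUnion])
  refine ⟨hφ, Entails.trans ?_ hent, hsig⟩
  intro ψ hψ
  obtain ⟨k, hk⟩ := Set.mem_iUnion.1 hψ
  have := interpolant_mem_cons hsig (hTL k) (hT k) (hs k) hk
  rw [hinsep k i] at this
  exact this.2.1

/-- A finite index set is handled by iterating the pairwise interpolation property. Without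
compactness this does not reach infinite unions, so an infinite index set is enumerated by `ℕ` and
the countable property is used. -/
theorem mem_cons_of_isDecomposition {L U T : Theory A} (hPIP : HasPIP.{u} L) (hU : U ⊆ L)
    {σ : Set (Symbol A)} {I : Set ℕ} {C : I → Theory A} (hdec : IsDecomposition.{u} L σ T C)
    (hinf : I.Infinite → HasCountablePIP.{u} L)
    (hinsep : ∀ i k, Inseparable.{u} L (sig U ∪ σ) (U ∪ C i) (U ∪ C k))
    {φ : Formula A} (hφ : φ ∈ L) (hsig : φ.sig ⊆ sig U ∪ σ)
    (h : Entails.{u} (U ∪ T) φ) (i : I) : φ ∈ Cons.{u} L (U ∪ C i) (sig U ∪ σ) := by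
  have h' : Entails.{u} (U ∪ ⋃ i, C i) φ := by
    intro Act Sit Obj _ _ _ M hM
    refine h Act Sit Obj M ?_
    rintro ψ (hψ | hψ)
    · exact hM ψ (Or.inl hψ)
    · exact (hdec.equivalent Act Sit Obj M).2 (fun χ hχ => hM χ (Or.inr hχ)) ψ hψ
  rcases I.finite_or_infinite with hI | hI
  · have := hI.fintype
    refine mem_cons_of_finset hPIP hU hdec.subset_logic hdec.sig_inter hinsep Finset.univ
      ⟨i, Finset.mem_univ i⟩ φ hφ hsig ?_ i
    simpa using h'
  · have := hI.to_subtype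
    obtain ⟨e⟩ : Nonempty (ℕ ≃ I) := ⟨(Nat.Subtype.orderIsoOfNat I).toEquiv⟩
    have := mem_cons_of_nat (C := C ∘ e) (hinf hI) hU (fun k => hdec.subset_logic _)
      (fun k l hkl => hdec.sig_inter _ _ (e.injective.ne hkl)) (fun k l => hinsep _ _) hφ hsig
      (by
        have : ⋃ k, (C ∘ e) k = ⋃ i, C i := e.surjective.iUnion_comp C
        rwa [this]) (e.symm i)
    simpa using this

end Interpolation

/-! ## Satisfaction of defined connectives and coincidence -/

section Basic

variable {A : Alphabet} {Act Sit Obj : Type u}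

section Connectives

variable (M : Str A Act Sit Obj) (v : Asg Act Sit Obj) (φ ψ : Formula A)

@[simp] theorem sat_neg : Sat M v φ.neg ↔ ¬ Sat M v φ := by
  simp [Formula.neg, Sat]

@[simp] theorem sat_and : Sat M v (φ.and ψ) ↔ Sat M v φ ∧ Sat M v ψ := by
  simp only [Formula.and, sat_neg, Sat]
  tauto

@[simp] theorem sat_or : Sat M v (φ.or ψ) ↔ Sat M v φ ∨ Sat M v ψ := by
  simp only [Formula.or, sat_neg, Sat]
  tauto

@[simp] theorem sat_iff : Sat M v (φ.iff ψ) ↔ (Sat M v φ ↔ Sat M v ψ) := by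
  simp only [Formula.iff, sat_and, Sat]
  tauto

@[simp] theorem sat_ex (k : Srt) (n : ℕ) :
    Sat M v (φ.ex k n) ↔ ∃ d, Sat M (v.setInd k n d) φ := by
  simp [Formula.ex, Sat]

theorem sat_bigAnd (l : List (Formula A)) :
    Sat M v (Formula.bigAnd l) ↔ ∀ φ ∈ l, Sat M v φ := by
  induction l with
  | nil => simp [Formula.bigAnd, Sat]
  | cons φ l ih => simp [Formula.bigAnd, ih]

end Connectives

theorem Asg.setInd_ind_self (v : Asg Act Sit Obj) (k : Srt) (n : ℕ) (d : Dom Act Sit Obj k) :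
    (v.setInd k n d).ind k n = d := by
  simp [Asg.setInd]

theorem Asg.setInd_ind_of_ne (v : Asg Act Sit Obj) {k k' : Srt} {n n' : ℕ}
    (d : Dom Act Sit Obj k) (h : (k', n') ≠ (k, n)) :
    (v.setInd k n d).ind k' n' = v.ind k' n' := by
  by_cases hk : k' = k
  · subst hk
    have : n' ≠ n := fun e => h (by rw [e])
    simp [Asg.setInd, this]
  · simp [Asg.setInd, hk]

theorem Asg.setInd_ind_of_srt_ne (v : Asg Act Sit Obj) {k k' : Srt} (n : ℕ)
    (d : Dom Act Sit Obj k) (h : k' ≠ k) : (v.setInd k n d).ind k' = v.ind k' := by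
  simp [Asg.setInd, h]

theorem Asg.setInd_eq_self (v : Asg Act Sit Obj) (k : Srt) (n : ℕ) :
    v.setInd k n (v.ind k n) = v := by
  simp [Asg.setInd]

theorem Asg.setPred_pred_self (v : Asg Act Sit Obj) (τ : List Srt) (n : ℕ)
    (R : (∀ i : Fin τ.length, Dom Act Sit Obj (τ.get i)) → Prop) :
    (v.setPred τ n R).pred τ n = R := by
  simp [Asg.setPred]

theorem Asg.setPred_pred_of_ne (v : Asg Act Sit Obj) {τ τ' : List Srt} {n n' : ℕ}
    (R : (∀ i : Fin τ.length, Dom Act Sit Obj (τ.get i)) → Prop) (h : (τ', n') ≠ (τ, n)) :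
    (v.setPred τ n R).pred τ' n' = v.pred τ' n' := by
  by_cases hk : τ' = τ
  · subst hk
    have : n' ≠ n := fun e => h (by rw [e])
    simp [Asg.setPred, this]
  · simp [Asg.setPred, hk]

/-- If a formula holds under all assignments, so does its universal closure over objects. -/
theorem sat_allObj_of_forall {M : Str A Act Sit Obj} {φ : Formula A} (m k : ℕ)
    (h : ∀ v, Sat M v φ) (v : Asg Act Sit Obj) : Sat M v (Formula.allObj k m φ) := by
  induction m generalizing k v with
  | zero => exact h v
  | succ m ih => exact fun d => ih (k + 1) _

theorem sat_of_sat_allObj {M : Str A Act Sit Obj} {φ : Formula A} (m k : ℕ)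
    {v : Asg Act Sit Obj} (h : Sat M v (Formula.allObj k m φ)) : Sat M v φ := by
  induction m generalizing k v with
  | zero => exact h
  | succ m ih =>
    have := h (v.ind .obj k)
    rw [Asg.setInd_eq_self] at this
    exact ih (k + 1) this

section Coincidence

variable {M : Str A Act Sit Obj} {v w : Asg Act Sit Obj}

theorem ObjTerm.eval_congr (t : ObjTerm A) (h : ∀ p ∈ t.vars, v.ind p.1 p.2 = w.ind p.1 p.2) :
    t.eval M v = t.eval M w := by
  induction t with
  | var n => exact h (.obj, n) rfl
  | const c => rfl
  | sfun f args ih =>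
    simp only [ObjTerm.eval]
    congr 1
    funext i
    exact ih i fun p hp => h p (Set.mem_iUnion.2 ⟨i, hp⟩)

theorem ActTerm.eval_congr (t : ActTerm A) (h : ∀ p ∈ t.vars, v.ind p.1 p.2 = w.ind p.1 p.2) :
    t.eval M v = t.eval M w := by
  cases t with
  | var n => exact h (.act, n) rfl
  | app f args =>
    simp only [ActTerm.eval]
    congr 1
    funext i
    exact (args i).eval_congr fun p hp => h p (Set.mem_iUnion.2 ⟨i, hp⟩)

theorem SitTerm.eval_congr (t : SitTerm A) (h : ∀ p ∈ t.vars, v.ind p.1 p.2 = w.ind p.1 p.2) :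
    t.eval M v = t.eval M w := by
  induction t with
  | var n => exact h (.sit, n) rfl
  | S0 => rfl
  | doS a s ih =>
    simp only [SitTerm.eval]
    rw [a.eval_congr fun p hp => h p (Or.inl hp), ih fun p hp => h p (Or.inr hp)]

theorem Term.eval_congr : ∀ (k : Srt) (t : Term A k)
    (_ : ∀ p ∈ Term.vars k t, v.ind p.1 p.2 = w.ind p.1 p.2),
    Term.eval M v k t = Term.eval M w k t
  | .act, t, h => ActTerm.eval_congr t h
  | .sit, t, h => SitTerm.eval_congr t h
  | .obj, t, h => ObjTerm.eval_congr t h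

/-- Coincidence: satisfaction depends only on the values of the free variables. -/
theorem sat_congr (φ : Formula A) (h : ∀ p ∈ φ.fv, v.ind p.1 p.2 = w.ind p.1 p.2)
    (h' : ∀ q ∈ φ.pfv, v.pred q.1 q.2 = w.pred q.1 q.2) : Sat M v φ ↔ Sat M w φ := by
  induction φ generalizing v w with
  | falsum => rfl
  | imp φ ψ ihφ ihψ =>
    exact imp_congr (ihφ (fun p hp => h p (Or.inl hp)) fun q hq => h' q (Or.inl hq))
      (ihψ (fun p hp => h p (Or.inr hp)) fun q hq => h' q (Or.inr hq))
  | eq k t t' =>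
    simp only [Sat]
    rw [Term.eval_congr k t fun p hp => h p (Or.inl hp),
      Term.eval_congr k t' fun p hp => h p (Or.inr hp)]
  | prec s s' =>
    simp only [Sat]
    rw [s.eval_congr fun p hp => h p (Or.inl hp), s'.eval_congr fun p hp => h p (Or.inr hp)]
  | poss a s =>
    simp only [Sat]
    rw [a.eval_congr fun p hp => h p (Or.inl hp), s.eval_congr fun p hp => h p (Or.inr hp)]
  | fluent F args s =>
    simp only [Sat]
    rw [s.eval_congr fun p hp => h p (Or.inr hp)]
    have : (fun i => (args i).eval M v) = fun i => (args i).eval M w := funext fun i =>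
      (args i).eval_congr fun p hp => h p (Or.inl (Set.mem_iUnion.2 ⟨i, hp⟩))
    rw [this]
  | spred P args =>
    simp only [Sat]
    have : (fun i => (args i).eval M v) = fun i => (args i).eval M w := funext fun i =>
      (args i).eval_congr fun p hp => h p (Set.mem_iUnion.2 ⟨i, hp⟩)
    rw [this]
  | pvar τ n args =>
    simp only [Sat]
    have : (fun i => Term.eval M v (τ.get i) (args i)) =
        fun i => Term.eval M w (τ.get i) (args i) := funext fun i =>
      Term.eval_congr _ (args i) fun p hp => h p (Set.mem_iUnion.2 ⟨i, hp⟩)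
    rw [this, h' (τ, n) rfl]
  | all k n φ ih =>
    refine forall_congr' fun d => ih (fun p hp => ?_) fun q hq => h' q hq
    by_cases hpn : p = (k, n)
    · subst hpn
      rw [Asg.setInd_ind_self, Asg.setInd_ind_self]
    · rw [Asg.setInd_ind_of_ne _ _ hpn, Asg.setInd_ind_of_ne _ _ hpn]
      exact h p ⟨hp, hpn⟩
  | allP τ n φ ih =>
    refine forall_congr' fun R => ih (fun p hp => h p hp) fun q hq => ?_
    by_cases hqn : q = (τ, n)
    · subst hqn
      rw [Asg.setPred_pred_self, Asg.setPred_pred_self]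
    · rw [Asg.setPred_pred_of_ne _ _ hqn, Asg.setPred_pred_of_ne _ _ hqn]
      exact h' q ⟨hq, hqn⟩

end Coincidence

theorem Formula.IsFirstOrder.pfv_eq {φ : Formula A} (h : φ.IsFirstOrder) : φ.pfv = ∅ := by
  induction φ with
  | imp φ ψ ihφ ihψ => simp [Formula.pfv, ihφ h.1, ihψ h.2]
  | pvar => exact h.elim
  | allP => exact h.elim
  | all k n φ ih => exact ih h
  | _ => rfl

/-- Coincidence for first-order formulas. -/
theorem sat_congr_of_isFirstOrder {M : Str A Act Sit Obj} {v w : Asg Act Sit Obj}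
    {φ : Formula A} (hφ : φ.IsFirstOrder) (h : ∀ p ∈ φ.fv, v.ind p.1 p.2 = w.ind p.1 p.2) :
    Sat M v φ ↔ Sat M w φ :=
  sat_congr φ h fun q hq => by rw [hφ.pfv_eq] at hq; exact hq.elim

/-! ## Fluent-free signatures -/

theorem ObjTerm.eval_withFluent (M : Str A Act Sit Obj)
    (g : (F : A.Fluent) → (Fin (A.fluentArity F) → Obj) → Sit → Prop) (v : Asg Act Sit Obj)
    (t : ObjTerm A) : t.eval { M with fluent := g } v = t.eval M v := by
  induction t with
  | sfun f args ih => simp only [ObjTerm.eval, ih]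
  | _ => rfl

theorem ActTerm.eval_withFluent (M : Str A Act Sit Obj)
    (g : (F : A.Fluent) → (Fin (A.fluentArity F) → Obj) → Sit → Prop) (v : Asg Act Sit Obj)
    (t : ActTerm A) : t.eval { M with fluent := g } v = t.eval M v := by
  cases t with
  | app f args => simp only [ActTerm.eval, ObjTerm.eval_withFluent]
  | _ => rfl

theorem SitTerm.eval_withFluent (M : Str A Act Sit Obj)
    (g : (F : A.Fluent) → (Fin (A.fluentArity F) → Obj) → Sit → Prop) (v : Asg Act Sit Obj)
    (t : SitTerm A) : t.eval { M with fluent := g } v = t.eval M v := by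
  induction t with
  | doS a s ih => simp only [SitTerm.eval, ih, ActTerm.eval_withFluent]
  | _ => rfl

theorem Term.eval_withFluent (M : Str A Act Sit Obj)
    (g : (F : A.Fluent) → (Fin (A.fluentArity F) → Obj) → Sit → Prop) (v : Asg Act Sit Obj) :
    ∀ (k : Srt) (t : Term A k), Term.eval { M with fluent := g } v k t = Term.eval M v k t
  | .act, t => ActTerm.eval_withFluent M g v t
  | .sit, t => SitTerm.eval_withFluent M g v t
  | .obj, t => ObjTerm.eval_withFluent M g v t

theorem FluentFree.mono {Δ Δ' : Set (Symbol A)} (h : FluentFree Δ') (hs : Δ ⊆ Δ') :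
    FluentFree Δ :=
  fun F hF => h F (hs hF)

/-- The truth of a fluent-free formula does not depend on the fluents. -/
theorem sat_withFluent_iff (M : Str A Act Sit Obj)
    (g : (F : A.Fluent) → (Fin (A.fluentArity F) → Obj) → Sit → Prop) {φ : Formula A}
    (hφ : FluentFree φ.sig) (v : Asg Act Sit Obj) :
    Sat { M with fluent := g } v φ ↔ Sat M v φ := by
  induction φ generalizing v with
  | falsum => rfl
  | imp φ ψ ihφ ihψ =>
    exact imp_congr (ihφ (hφ.mono Set.subset_union_left) v) (ihψ (hφ.mono Set.subset_union_right) v)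
  | fluent F args s => exact (hφ F (Or.inl (Or.inl rfl))).elim
  | all k n φ ih => exact forall_congr' fun d => ih hφ _
  | allP τ n φ ih => exact forall_congr' fun R => ih hφ _
  | _ => simp only [Sat, Term.eval_withFluent, SitTerm.eval_withFluent, ActTerm.eval_withFluent,
      ObjTerm.eval_withFluent]

/-! ## Uniform formulas in corresponding situations -/

/-- Two domain elements correspond: they are equal, or they are the situations `p` and `p'`. -/
def DomRel {Sit' : Type u} (p : Sit) (p' : Sit') :
    (k : Srt) → Dom Act Sit Obj k → Dom Act Sit' Obj k → Prop
  | .act, x, y => x = y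
  | .sit, x, y => x = p ∧ y = p'
  | .obj, x, y => x = y

/-- Replace all situations by `p'`. -/
def domMap {Sit' : Type u} (p' : Sit') :
    (k : Srt) → Dom Act Sit Obj k → Dom Act Sit' Obj k
  | .act, x => x
  | .sit, _ => p'
  | .obj, x => x

/-- Pulling a relation back along `domMap` thus gives a relation that agrees with it on
corresponding tuples; this supplies witnesses for predicate quantifiers and assignments. -/
theorem DomRel.domMap_right_eq {Sit' : Type u} {p : Sit} {p' : Sit'} :
    ∀ {k : Srt} {x : Dom Act Sit Obj k} {y : Dom Act Sit' Obj k}, DomRel p p' k x y →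
      domMap p' k x = y
  | .act, _, _, h => h
  | .sit, _, _, h => h.2.symm
  | .obj, _, _, h => h

theorem DomRel.domMap_left_eq {Sit' : Type u} {p : Sit} {p' : Sit'} :
    ∀ {k : Srt} {x : Dom Act Sit Obj k} {y : Dom Act Sit' Obj k}, DomRel p p' k x y →
      domMap p k y = x
  | .act, _, _, h => h.symm
  | .sit, _, _, h => h.1.symm
  | .obj, _, _, h => h.symm

/-- Assignments into structures that share actions and objects correspond: they agree on actions
and objects, and on relations between actions, objects and the situation `p` resp. `p'`. -/
structure AsgRel {Sit' : Type u} (p : Sit) (p' : Sit') (v : Asg Act Sit Obj)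
    (v' : Asg Act Sit' Obj) : Prop where
  act : v.ind .act = v'.ind .act
  obj : v.ind .obj = v'.ind .obj
  pred : ∀ τ n x y, (∀ i, DomRel p p' (τ.get i) (x i) (y i)) → (v.pred τ n x ↔ v'.pred τ n y)

theorem AsgRel.setInd {Sit' : Type u} {p : Sit} {p' : Sit'} {v : Asg Act Sit Obj}
    {v' : Asg Act Sit' Obj} (h : AsgRel p p' v v') :
    ∀ (k : Srt) (n : ℕ) (d : Dom Act Sit Obj k), k ≠ .sit →
      AsgRel p p' (v.setInd k n d) (v'.setInd k n (domMap p' k d))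
  | .act, n, d, _ => ⟨by simp [Asg.setInd, h.act, domMap]; rfl, h.obj, h.pred⟩
  | .sit, n, d, hk => (hk rfl).elim
  | .obj, n, d, _ => ⟨h.act, by simp [Asg.setInd, h.obj, domMap]; rfl, h.pred⟩

theorem AsgRel.setPred {Sit' : Type u} {p : Sit} {p' : Sit'} {v : Asg Act Sit Obj}
    {v' : Asg Act Sit' Obj} (h : AsgRel p p' v v') (τ : List Srt) (n : ℕ)
    {R : (∀ i : Fin τ.length, Dom Act Sit Obj (τ.get i)) → Prop}
    {R' : (∀ i : Fin τ.length, Dom Act Sit' Obj (τ.get i)) → Prop}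
    (hR : ∀ x y, (∀ i, DomRel p p' (τ.get i) (x i) (y i)) → (R x ↔ R' y)) :
    AsgRel p p' (v.setPred τ n R) (v'.setPred τ n R') := by
  refine ⟨h.act, h.obj, fun τ' n' x y hxy => ?_⟩
  by_cases hq : (τ', n') = (τ, n)
  · obtain ⟨rfl, rfl⟩ := Prod.mk.inj hq
    rw [Asg.setPred_pred_self, Asg.setPred_pred_self]
    exact hR x y hxy
  · rw [Asg.setPred_pred_of_ne _ _ hq, Asg.setPred_pred_of_ne _ _ hq]
    exact h.pred τ' n' x y hxy

/-- Every assignment has a corresponding one in a structure with the same actions and objects. -/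
theorem exists_asgRel {Sit' : Type u} (p : Sit) (p' : Sit') (v' : Asg Act Sit' Obj) :
    ∃ v : Asg Act Sit Obj, AsgRel p p' v v' := by
  refine ⟨⟨fun | .act => v'.ind .act | .sit => fun _ => p | .obj => v'.ind .obj,
    fun τ n x => v'.pred τ n fun i => domMap p' _ (x i)⟩, rfl, rfl, fun τ n x y hxy => ?_⟩
  have : (fun i => domMap p' (τ.get i) (x i)) = y := funext fun i => (hxy i).domMap_right_eq
  simp only [this]

/-- Two structures with the same actions and objects, the same interpretation of all symbols
without situation arguments, and the same fluents at the situations `p` and `p'`. -/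
structure StateEq {Sit' : Type u} (M : Str A Act Sit Obj) (M' : Str A Act Sit' Obj) (p : Sit)
    (p' : Sit') : Prop where
  actFn : M.actFn = M'.actFn
  const : M.const = M'.const
  spred : M.spred = M'.spred
  sfun : M.sfun = M'.sfun
  fluent : ∀ F x, M.fluent F x p ↔ M'.fluent F x p'

section Transfer

variable {Sit' : Type u} {M : Str A Act Sit Obj} {M' : Str A Act Sit' Obj} {p : Sit} {p' : Sit'}
  {v : Asg Act Sit Obj} {v' : Asg Act Sit' Obj}

theorem StateEq.objEval (h : StateEq M M' p p') (hv : AsgRel p p' v v') (t : ObjTerm A) :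
    t.eval M v = t.eval M' v' := by
  induction t with
  | var n => exact congrFun hv.obj n
  | const c => exact congrFun h.const c
  | sfun f args ih => simp only [ObjTerm.eval, ih, h.sfun]

theorem StateEq.actEval (h : StateEq M M' p p') (hv : AsgRel p p' v v') (t : ActTerm A) :
    t.eval M v = t.eval M' v' := by
  cases t with
  | var n => exact congrFun hv.act n
  | app f args => simp only [ActTerm.eval, h.objEval hv, h.actFn]

theorem SitTerm.replace_self_left (S S' : SitTerm A) : SitTerm.replace S S' S = S' := by
  cases S <;> simp [SitTerm.replace]

/-- Uniformity forces a situation argument to be `S`, whose values `p` and `p'` are the only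
situations that `DomRel` relates. -/
theorem StateEq.termEval (h : StateEq M M' p p') (hv : AsgRel p p' v v') {S S' : SitTerm A}
    (hS : S.eval M v = p) (hS' : S'.eval M' v' = p') :
    ∀ (k : Srt) (t : Term A k), Term.SitIs S k t →
      DomRel p p' k (Term.eval M v k t) (Term.eval M' v' k (Term.replace S S' k t))
  | .act, t, _ => h.actEval hv t
  | .obj, t, _ => h.objEval hv t
  | .sit, t, ht => by
    have ht : t = S := ht
    subst ht
    exact ⟨hS, (congrArg _ (SitTerm.replace_self_left t S')).trans hS'⟩

/-- The value of a term without action and object variables depends only on the situation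
variables. -/
theorem SitTerm.eval_congr_of_vars_subset {S : SitTerm A} (hS : S.vars ⊆ {q | q.1 = .sit})
    {v w : Asg Act Sit Obj} (h : v.ind .sit = w.ind .sit) : S.eval M v = S.eval M w := by
  refine S.eval_congr fun q hq => ?_
  obtain ⟨k, n⟩ := q
  obtain rfl : k = .sit := hS hq
  exact congrFun h n

/-- A formula uniform in `S` holds at the value of `S` in one structure iff its translation holds at
the value of `S'` in another structure with the same state. -/
theorem StateEq.sat_replace_iff (h : StateEq M M' p p') {S S' : SitTerm A}
    (hSv : S.vars ⊆ {q | q.1 = .sit}) (hSv' : S'.vars ⊆ {q | q.1 = .sit})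
    (hv : AsgRel p p' v v') (hS : S.eval M v = p) (hS' : S'.eval M' v' = p') {φ : Formula A}
    (hφ : φ.Uniform S) : Sat M v φ ↔ Sat M' v' (φ.replace S S') := by
  induction φ generalizing v v' with
  | falsum => rfl
  | imp φ ψ ihφ ihψ => exact imp_congr (ihφ hv hS hS' hφ.1) (ihψ hv hS hS' hφ.2)
  | eq k t t' =>
    cases k with
    | act => exact iff_of_eq (congrArg₂ _ (h.actEval hv t) (h.actEval hv t'))
    | sit => exact (hφ rfl).elim
    | obj => exact iff_of_eq (congrArg₂ _ (h.objEval hv t) (h.objEval hv t'))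
  | prec => exact hφ.elim
  | poss => exact hφ.elim
  | fluent F args s =>
    obtain rfl : s = S := hφ
    simp only [Sat, Formula.replace, SitTerm.replace_self_left, hS, hS', h.objEval hv, h.fluent]
  | spred P args => simp only [Sat, Formula.replace, h.objEval hv, h.spred]
  | pvar τ n args => exact hv.pred _ _ _ _ fun i => h.termEval hv hS hS' _ _ (hφ i)
  | all k n φ ih =>
    have key : ∀ d, Sat M (v.setInd k n d) φ ↔
        Sat M' (v'.setInd k n (domMap p' k d)) (φ.replace S S') := fun d =>
      ih (hv.setInd k n d hφ.1)
        (by rw [← hS]; exact SitTerm.eval_congr_of_vars_subset hSv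
              (Asg.setInd_ind_of_srt_ne _ _ _ hφ.1.symm))
        (by rw [← hS']; exact SitTerm.eval_congr_of_vars_subset hSv'
              (Asg.setInd_ind_of_srt_ne _ _ _ hφ.1.symm)) hφ.2
    -- For actions and objects the two domains coincide and `domMap` is the identity.
    simp only [Sat, Formula.replace, key]
    cases k with
    | act => rfl
    | sit => exact (hφ.1 rfl).elim
    | obj => rfl
  | allP τ n φ ih =>
    have key : ∀ R R', (∀ x y, (∀ i, DomRel p p' (τ.get i) (x i) (y i)) → (R x ↔ R' y)) →
        (Sat M (v.setPred τ n R) φ ↔ Sat M' (v'.setPred τ n R') (φ.replace S S')) :=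
      fun R R' hR => ih (hv.setPred τ n hR)
        (by rw [← hS]; exact SitTerm.eval_congr_of_vars_subset hSv rfl)
        (by rw [← hS']; exact SitTerm.eval_congr_of_vars_subset hSv' rfl) hφ
    constructor
    · intro H R'
      -- The two structures have different relations to quantify over, but only values at `p` and
      -- `p'` matter, so the pullback along `domMap` is a sufficient counterpart, here and in the
      -- other direction.
      refine (key (fun x => R' fun i => domMap p' _ (x i)) R' fun x y hxy => ?_).1 (H _)
      rw [show (fun i => domMap p' _ (x i)) = y from funext fun i => (hxy i).domMap_right_eq]
    · intro H R
      refine (key R (fun y => R fun i => domMap p _ (y i)) fun x y hxy => ?_).2 (H _)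
      rw [show (fun i => domMap p _ (y i)) = x from funext fun i => (hxy i).domMap_left_eq]

end Transfer

theorem SitTerm.replace_self (S t : SitTerm A) : SitTerm.replace S S t = t := by
  induction t with
  | doS a s ih => simp only [SitTerm.replace, ih]; split_ifs with h <;> simp [h]
  | _ => simp only [SitTerm.replace]; split_ifs with h <;> simp [h]

theorem Term.replace_self (S : SitTerm A) : ∀ (k : Srt) (t : Term A k), Term.replace S S k t = t
  | .act, _ => rfl
  | .sit, t => SitTerm.replace_self S t
  | .obj, _ => rfl

theorem Formula.replace_self (S : SitTerm A) (φ : Formula A) : φ.replace S S = φ := by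
  induction φ <;> simp_all [Formula.replace, SitTerm.replace_self, Term.replace_self]

/-- The case `S' = S` of `sat_replace_iff`, where the replacement changes nothing. -/
theorem StateEq.sat_iff {Sit' : Type u} {M : Str A Act Sit Obj} {M' : Str A Act Sit' Obj}
    {p : Sit} {p' : Sit'} {v : Asg Act Sit Obj} {v' : Asg Act Sit' Obj} (h : StateEq M M' p p')
    {S : SitTerm A} (hSv : S.vars ⊆ {q | q.1 = .sit}) (hv : AsgRel p p' v v')
    (hS : S.eval M v = p) (hS' : S.eval M' v' = p') {φ : Formula A} (hφ : φ.Uniform S) :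
    Sat M v φ ↔ Sat M' v' φ := by
  rw [h.sat_replace_iff hSv hSv hv hS hS' hφ, Formula.replace_self]

end Basic

/-! ## Unique name axioms -/

section Una

variable {A : Alphabet}

theorem Formula.sig_allObj (k m : ℕ) (φ : Formula A) : (allObj k m φ).sig = φ.sig := by
  induction m generalizing k with
  | zero => rfl
  | succ m ih => exact ih (k + 1)

theorem Formula.sig_bigAnd_subset {Δ : Set (Symbol A)} (l : List (Formula A))
    (h : ∀ φ ∈ l, φ.sig ⊆ Δ) : (bigAnd l).sig ⊆ Δ := by
  induction l with
  | nil => simp [bigAnd, neg, Formula.sig]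
  | cons φ l ih =>
    simp only [List.mem_cons, forall_eq_or_imp] at h
    simp [bigAnd, Formula.and, neg, Formula.sig, h.1, ih h.2]

/-- Only action functions and object constants occur in these axioms; this is what keeps `Δ`
fluent-free. -/
theorem fluentFree_sig_una (D : BAT A) : FluentFree (sig D.una) := by
  intro F hF
  obtain ⟨φ, hφ, hF⟩ := Set.mem_iUnion₂.1 hF
  rcases hφ with (⟨c, d, -, -, -, rfl⟩ | ⟨f, g, -, -, -, rfl⟩) | ⟨f, -, rfl⟩
  · simp [unaConst, Formula.neg, Formula.sig, Term.sig, ObjTerm.sig] at hF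
  · simp [unaAct, Formula.sig_allObj, Formula.neg, Formula.sig, Term.sig, ActTerm.sig, ov,
      ObjTerm.sig] at hF
  · rw [unaInj, Formula.sig_allObj] at hF
    rcases hF with hF | hF
    · simp [Formula.sig, Term.sig, ActTerm.sig, ov, ObjTerm.sig] at hF
    · refine Formula.sig_bigAnd_subset (Δ := ∅) _ (fun φ hφ => ?_) hF
      obtain ⟨i, rfl⟩ := List.mem_ofFn.1 hφ
      simp [Formula.sig, Term.sig, ov, ObjTerm.sig]

variable {Act Sit Obj : Type u}

/-- The assignment that gives the first `n` object variables the values `x` and the next `m` ones the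
values `y`. -/
theorem exists_asg_pair [Nonempty Act] [Nonempty Sit] [Nonempty Obj] {n m : ℕ} (x : Fin n → Obj)
    (y : Fin m → Obj) : ∃ v : Asg Act Sit Obj,
      (∀ i : Fin n, v.ind .obj i = x i) ∧ ∀ i : Fin m, v.ind .obj (n + i) = y i := by
  classical
  let g : ℕ → Obj := fun i => if h : i < n then x ⟨i, h⟩ else
    if h : i - n < m then y ⟨i - n, h⟩ else Classical.arbitrary Obj
  refine ⟨⟨fun k => match k with
      | .act => fun _ => Classical.arbitrary Act
      | .sit => fun _ => Classical.arbitrary Sit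
      | .obj => g, fun _ _ _ => True⟩,
    fun i => show g i = x i from ?_, fun i => show g (n + i) = y i from ?_⟩
  · simp [g]
  · simp [g]

/-- The right-hand side involves neither situations nor fluents, so the unique name axioms carry
over to every structure with the same constants and action functions, whatever its situations are.
-/
theorem models_una_iff [Nonempty Act] [Nonempty Sit] [Nonempty Obj] (D : BAT A)
    (M : Str A Act Sit Obj) : Models M D.una ↔
      (∀ c d, .const c ∈ D.signature → .const d ∈ D.signature → c ≠ d → M.const c ≠ M.const d) ∧
      (∀ f g, .actFn f ∈ D.signature → .actFn g ∈ D.signature → f ≠ g →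
        ∀ x y, M.actFn f x ≠ M.actFn g y) ∧
      ∀ f, .actFn f ∈ D.signature → Function.Injective (M.actFn f) := by
  constructor
  · intro h
    refine ⟨fun c d hc hd hcd => ?_, fun f g hf hg hfg x y => ?_, fun f hf x y hxy => ?_⟩
    · obtain ⟨v, -⟩ := exists_asg_pair (Act := Act) (Sit := Sit) (Obj := Obj)
        (n := 0) (m := 0) (fun i => i.elim0) (fun i => i.elim0)
      have := h _ (Or.inl (Or.inl ⟨c, d, hc, hd, hcd, rfl⟩)) v
      rw [unaConst, sat_neg] at this
      exact this
    · obtain ⟨v, hx, hy⟩ := exists_asg_pair (Act := Act) (Sit := Sit) x y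
      have := sat_of_sat_allObj _ _ (h _ (Or.inl (Or.inr ⟨f, g, hf, hg, hfg, rfl⟩)) v)
      rw [sat_neg] at this
      simp only [Sat, Term.eval, ActTerm.eval, ov, ObjTerm.eval, hx, hy] at this
      exact this
    · obtain ⟨v, hx, hy⟩ := exists_asg_pair (Act := Act) (Sit := Sit) x y
      have := sat_of_sat_allObj _ _ (h _ (Or.inr ⟨f, hf, rfl⟩) v)
      simp only [Sat, sat_bigAnd, List.forall_mem_ofFn_iff, Term.eval, ActTerm.eval, ov,
        ObjTerm.eval, hx, hy] at this
      exact funext (this hxy)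
  · rintro ⟨hc, hfg, hf⟩ φ hφ
    rcases hφ with (⟨c, d, hc', hd, hcd, rfl⟩ | ⟨f, g, hf', hg, hne, rfl⟩) | ⟨f, hf', rfl⟩ <;> intro v
    · rw [unaConst, sat_neg]
      exact hc c d hc' hd hcd
    · refine sat_allObj_of_forall _ _ (fun v => ?_) v
      rw [sat_neg]
      exact hfg f g hf' hg hne _ _
    · refine sat_allObj_of_forall _ _ (fun v h => ?_) v
      have := hf f hf' h
      simp only [Sat, sat_bigAnd, List.forall_mem_ofFn_iff]
      exact fun i => congrFun this i

end Una

/-! ## The tree of situations over a given initial state -/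

section Tree

variable {A : Alphabet}

theorem Formula.fv_exObj_subset (k m : ℕ) (φ : Formula A) :
    (exObj k m φ).fv ⊆ φ.fv \ {p | p.1 = .obj ∧ k ≤ p.2 ∧ p.2 < k + m} := by
  induction m generalizing k with
  | zero =>
    rintro p hp
    exact ⟨hp, fun h => by have := h.2; omega⟩
  | succ m ih =>
    rintro ⟨s, i⟩ hp
    simp only [exObj, ex, neg, Formula.fv, Set.union_empty] at hp
    obtain ⟨hp, hne⟩ := hp
    obtain ⟨hp, hi⟩ := ih (k + 1) hp
    refine ⟨hp, fun ⟨hs, h1, h2⟩ => hi ⟨hs, ?_, by dsimp only at *; omega⟩⟩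
    rcases h1.eq_or_lt with rfl | h
    · exact (hne (by rw [show s = .obj from hs]; rfl)).elim
    · exact h

theorem Formula.fv_bigOr_subset {X : Set (Srt × ℕ)} (l : List (Formula A))
    (h : ∀ φ ∈ l, φ.fv ⊆ X) : (bigOr l).fv ⊆ X := by
  induction l with
  | nil => simp [bigOr, Formula.fv]
  | cons φ l ih =>
    simp only [List.mem_cons, forall_eq_or_imp] at h
    simp [bigOr, Formula.or, neg, Formula.fv, h.1, ih h.2]

theorem Formula.isFirstOrder_bigOr (l : List (Formula A)) (h : ∀ φ ∈ l, φ.IsFirstOrder) :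
    (bigOr l).IsFirstOrder := by
  induction l with
  | nil => trivial
  | cons φ l ih =>
    simp only [List.mem_cons, forall_eq_or_imp] at h
    exact ⟨⟨h.1, trivial⟩, ih h.2⟩

theorem Formula.uniform_bigOr {S : SitTerm A} (l : List (Formula A)) (h : ∀ φ ∈ l, φ.Uniform S) :
    (bigOr l).Uniform S := by
  induction l with
  | nil => trivial
  | cons φ l ih =>
    simp only [List.mem_cons, forall_eq_or_imp] at h
    exact ⟨⟨h.1, trivial⟩, ih h.2⟩

theorem Formula.isFirstOrder_exObj {φ : Formula A} (h : φ.IsFirstOrder) (k m : ℕ) :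
    (exObj k m φ).IsFirstOrder := by
  induction m generalizing k with
  | zero => exact h
  | succ m ih => exact ⟨⟨ih (k + 1), trivial⟩, trivial⟩

theorem Formula.uniform_exObj {S : SitTerm A} {φ : Formula A} (h : φ.Uniform S) (k m : ℕ) :
    (exObj k m φ).Uniform S := by
  induction m generalizing k with
  | zero => exact h
  | succ m ih => exact ⟨⟨by simp, ih (k + 1), trivial⟩, trivial⟩

/-- The variables that may be free in the axioms for a symbol with `n` object arguments. -/
def axiomVars (n : ℕ) : Set (Srt × ℕ) := {p | p.1 = .obj ∧ p.2 < n} ∪ {(.act, 0), (.sit, 0)}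

/-- First-order formulas uniform in the first situation variable, with free variables among those of
an axiom for a symbol with `n` object arguments. -/
structure IsCondition (n : ℕ) (φ : Formula A) : Prop where
  isFirstOrder : φ.IsFirstOrder
  uniform : φ.Uniform (.var 0)
  fv_subset : φ.fv ⊆ axiomVars n

theorem Effect.WellFormed.isCondition {σ : Set (Symbol A)} {n : ℕ} {e : Effect A}
    (h : e.WellFormed σ n) : IsCondition n (e.toFormula n) := by
  have hfo : (Formula.and (.eq .act (ActTerm.var 0) (ActTerm.app e.f e.args)) e.ctx).IsFirstOrder :=
    ⟨⟨trivial, h.ctx_firstOrder, trivial⟩, trivial⟩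
  have hun : (Formula.and (.eq .act (ActTerm.var 0) (ActTerm.app e.f e.args)) e.ctx).Uniform
      (.var 0) := ⟨⟨by simp [Formula.Uniform], h.ctx_uniform, trivial⟩, trivial⟩
  refine ⟨Formula.isFirstOrder_exObj hfo _ _, Formula.uniform_exObj hun _ _, ?_⟩
  refine (Formula.fv_exObj_subset _ _ _).trans ?_
  rintro ⟨k, i⟩ ⟨hp, hi⟩
  -- The variables numbered `n` to `n + m - 1` are bound by the block `∃ ȳ`, so a free one below `n
  -- + m` is one of the `x̄`.
  have key : (k, i) ∈ {p : Srt × ℕ | p.1 = .obj ∧ p.2 < n + e.m} → (k, i) ∈ axiomVars n := by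
    rintro ⟨hk, hlt⟩
    refine Or.inl ⟨hk, ?_⟩
    by_contra hn
    exact hi ⟨hk, not_lt.1 hn, hlt⟩
  simp only [Formula.and, Formula.neg, Formula.fv, Term.vars, ActTerm.vars, Set.union_empty] at hp
  rcases hp with (hp | hp) | hp
  · exact Or.inr (Or.inl hp)
  · obtain ⟨j, hj⟩ := Set.mem_iUnion.1 hp
    exact key (h.args_vars j hj)
  · rcases h.ctx_fv hp with hp | hp
    · exact key hp
    · exact Or.inr (Or.inr hp)

theorem isCondition_bigOr {n : ℕ} (l : List (Formula A)) (h : ∀ φ ∈ l, IsCondition n φ) :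
    IsCondition n (Formula.bigOr l) :=
  ⟨Formula.isFirstOrder_bigOr l fun φ hφ => (h φ hφ).1,
    Formula.uniform_bigOr l fun φ hφ => (h φ hφ).2, Formula.fv_bigOr_subset l fun φ hφ => (h φ hφ).3⟩

namespace BAT

/-- The right-hand side of the successor state axiom of a fluent. -/
def ssRhs (D : BAT A) (F : A.Fluent) : Formula A :=
  .or (.bigOr ((D.pos F).map (Effect.toFormula (A.fluentArity F))))
    (.and (.fluent F (fun i => ov i) (.var 0))
      (.neg (.bigOr ((D.neg F).map (Effect.toFormula (A.fluentArity F))))))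

theorem isCondition_ssRhs (D : BAT A) {F : A.Fluent} (hF : .fluent F ∈ D.signature) :
    IsCondition (A.fluentArity F) (D.ssRhs F) := by
  have hpos := isCondition_bigOr ((D.pos F).map (Effect.toFormula (A.fluentArity F)))
    (List.forall_mem_map.2 fun e he => (D.pos_wf F hF e he).isCondition)
  have hneg := isCondition_bigOr ((D.neg F).map (Effect.toFormula (A.fluentArity F)))
    (List.forall_mem_map.2 fun e he => (D.neg_wf F hF e he).isCondition)
  refine ⟨⟨⟨hpos.1, trivial⟩, ⟨trivial, ⟨hneg.1, trivial⟩, trivial⟩, trivial⟩,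
    ⟨⟨hpos.2, trivial⟩, ⟨rfl, ⟨hneg.2, trivial⟩, trivial⟩, trivial⟩, ?_⟩
  simp only [ssRhs, Formula.or, Formula.and, Formula.neg, Formula.fv, Set.union_empty]
  refine Set.union_subset hpos.3 (Set.union_subset (Set.union_subset ?_ ?_) hneg.3)
  · refine Set.iUnion_subset fun i => ?_
    rintro _ rfl
    exact Or.inl ⟨rfl, i.2⟩
  · rintro _ rfl
    exact Or.inr (Or.inr rfl)

theorem isCondition_pre (D : BAT A) {f : A.ActFn} (hf : .actFn f ∈ D.signature) :
    IsCondition (A.actArity f) (D.pre f) := by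
  refine ⟨D.pre_firstOrder f hf, D.pre_uniform f hf, (D.pre_fv f hf).trans ?_⟩
  exact Set.union_subset_union_right _ (by simp)

end BAT

/-! ### One-situation structures and the tree model. -/

variable {Act Sit Obj : Type u}

/-- Truth values of the fluents in a single situation. -/
abbrev State (A : Alphabet) (Obj : Type u) :=
  (F : A.Fluent) → (Fin (A.fluentArity F) → Obj) → Prop

/-- The structure with a single situation in the given state. -/
def pointStr (M : Str A Act Sit Obj) (s : State A Obj) : Str A Act PUnit.{u + 1} Obj where
  -- Arbitrary values for `do`, the order and `Poss`: conditions uniform in a situation variable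
  -- contain none of them.
  doS _ _ := ⟨⟩
  S0 := ⟨⟩
  prec _ _ := True
  poss _ _ := True
  actFn := M.actFn
  fluent F x _ := s F x
  const := M.const
  spred := M.spred
  sfun := M.sfun

open Classical in
/-- The assignment of the object variables `0, …, n - 1` and of the action variables. -/
noncomputable def pointAsg [Nonempty Obj] {n : ℕ} (x : Fin n → Obj) (a : Act) :
    Asg Act PUnit.{u + 1} Obj where
  ind
    | .act => fun _ => a
    | .sit => fun _ => ⟨⟩
    -- Object variables from `n` on are not free in a condition, so the default value is immaterial.
    | .obj => fun i => if h : i < n then x ⟨i, h⟩ else Classical.arbitrary Obj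
  pred _ _ _ := True

/-- A condition speaks about one state only. Evaluating it in a one-point structure lets
`stateAfter` be defined by recursion before the tree exists; this lemma says that the result is the
truth value in the tree. -/
theorem sat_pointStr_iff [Nonempty Obj] {M : Str A Act Sit Obj} {s : State A Obj} {Sit' : Type u}
    {M' : Str A Act Sit' Obj} {v' : Asg Act Sit' Obj}
    (h : StateEq (pointStr M s) M' ⟨⟩ (v'.ind .sit 0)) {n : ℕ} {φ : Formula A}
    (hφ : IsCondition n φ) :
    Sat (pointStr M s) (pointAsg (fun i : Fin n => v'.ind .obj i) (v'.ind .act 0)) φ ↔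
      Sat M' v' φ := by
  obtain ⟨v, hv⟩ := exists_asgRel (Sit := PUnit.{u + 1}) ⟨⟩ (v'.ind .sit 0) v'
  rw [← h.sat_iff (S := .var 0) (by rintro _ rfl; rfl) hv rfl rfl hφ.uniform]
  refine sat_congr_of_isFirstOrder hφ.isFirstOrder fun p hp => ?_
  rcases hφ.fv_subset hp with ⟨hk, hi⟩ | hp | hp
  · obtain ⟨k, i⟩ := p
    obtain rfl : k = .obj := hk
    have hi : i < n := hi
    rw [hv.obj]
    exact dif_pos hi
  · subst hp
    rw [hv.act]
    rfl
  · subst hp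
    rfl

/-- The state after a list of actions, the last one first. -/
noncomputable def stateAfter [Nonempty Obj] (D : BAT A) (M : Str A Act Sit Obj) :
    List Act → State A Obj
  | [] => fun F x => M.fluent F x M.S0
  -- The successor state axiom read as a definition. Fluents outside the signature have no axiom, so
  -- their values do not matter.
  | a :: s => fun F x => Sat (pointStr M (stateAfter D M s)) (pointAsg x a) (D.ssRhs F)

/-- The model of the axioms other than the initial theory whose situations are the lists of actions
and whose initial state is that of `M`. -/
noncomputable def treeStr [Nonempty Obj] (D : BAT A) (M : Str A Act Sit Obj) :
    Str A Act (List Act) Obj where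
  doS a s := a :: s
  S0 := []
  -- The latest action is the head of the list, so earlier situations are suffixes.
  prec s t := s <:+ t
  poss a s := ∃ f x, .actFn f ∈ D.signature ∧ a = M.actFn f x ∧
    Sat (pointStr M (stateAfter D M s)) (pointAsg x a) (D.pre f)
  actFn := M.actFn
  fluent F x s := stateAfter D M s F x
  const := M.const
  spred := M.spred
  sfun := M.sfun

theorem stateEq_point_tree [Nonempty Obj] (D : BAT A) (M : Str A Act Sit Obj) (s : List Act) :
    StateEq (pointStr M (stateAfter D M s)) (treeStr D M) ⟨⟩ s :=
  ⟨rfl, rfl, rfl, rfl, fun _ _ => Iff.rfl⟩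

theorem stateEq_tree [Nonempty Obj] (D : BAT A) (M : Str A Act Sit Obj) :
    StateEq M (treeStr D M) M.S0 [] :=
  ⟨rfl, rfl, rfl, rfl, fun _ _ => Iff.rfl⟩

/-- Lists are freely generated: `cons` is injective, `[]` has no proper suffix, and the second-order
induction axiom is list induction. -/
theorem models_foundational_tree [Nonempty Obj] (D : BAT A) (M : Str A Act Sit Obj) :
    Models (treeStr D M) (foundational A) := by
  rintro φ (rfl | rfl | rfl | rfl) v
  · intro a₁ a₂ s₁ s₂ h
    rw [sat_and]
    exact List.cons.inj h
  · intro s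
    rw [sat_neg, sat_and, sat_neg]
    rintro ⟨h, h'⟩
    exact h' (List.suffix_nil.1 h)
  · intro s₁ s₂
    rw [sat_iff, sat_or, sat_ex]
    change s₁ <:+ s₂ ↔ (∃ a, a :: s₁ <:+ s₂) ∨ s₁ = s₂
    constructor
    · rintro ⟨t, rfl⟩
      -- The last entry of the prefix `t` is the action performed directly in `s₁`.
      rcases t.eq_nil_or_concat with rfl | ⟨t, a, rfl⟩
      · exact Or.inr rfl
      · exact Or.inl ⟨a, t, by rw [List.concat_eq_append]; exact List.append_cons t a s₁⟩
    · rintro (⟨a, h⟩ | rfl)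
      · exact (List.suffix_cons a s₁).trans h
      · exact List.suffix_refl _
  · intro R h s
    rw [sat_and] at h
    obtain ⟨h0, hs⟩ := h
    -- The one-entry argument tuples in the axiom are separate functions by pattern matching; they
    -- are identified with `tup` by extensionality.
    let tup : List Act → ∀ i : Fin [Srt.sit].length, Dom Act (List Act) Obj ([Srt.sit].get i) :=
      fun s => fun | ⟨0, _⟩ => s
    have key : ∀ s, R (tup s) := by
      intro s
      induction s with
      | nil =>
        simp only [Sat, Asg.setPred_pred_self] at h0
        convert h0 using 1
        funext ⟨0, _⟩
        rfl
      | cons a s ih =>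
        have := hs a s
        simp only [Sat, Asg.setInd, Asg.setPred, Function.update_self] at this
        convert this ?_ using 1
        · funext ⟨0, _⟩
          rfl
        · convert ih using 1
          funext ⟨0, _⟩
          rfl
    have := key s
    simp only [Sat, Asg.setInd, Asg.setPred, Function.update_self]
    convert this using 1
    funext ⟨0, _⟩
    rfl

/-- The successor state axioms hold by the definition of `stateAfter`. The precondition axioms need
unique names: otherwise one action could have two descriptions with conflicting preconditions. -/
theorem models_background_tree [Nonempty Act] [Nonempty Sit] [Nonempty Obj] (D : BAT A)
    {M : Str A Act Sit Obj} (hM : Models M D.una) : Models (treeStr D M) D.background := by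
  rintro φ (((hφ | ⟨F, hF, rfl⟩) | ⟨f, hf, rfl⟩) | hφ)
  · exact models_foundational_tree D M φ hφ
  · refine sat_allObj_of_forall _ _ fun v a s => ?_
    rw [sat_iff]
    refine Iff.trans ?_ (sat_pointStr_iff (stateEq_point_tree D M _) (D.isCondition_ssRhs hF))
    rfl
  · refine sat_allObj_of_forall _ _ fun v s => ?_
    rw [sat_iff]
    generalize v.setInd .sit 0 s = w
    let x : Fin (A.actArity f) → Obj := fun i => w.ind .obj i
    -- `pointAsg` gives the action variable the value `f(x̄)`, while the precondition axiom leaves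
    -- it unspecified. It is not free in `D.pre f`, so it may be reset.
    let w' := w.setInd .act 0 (M.actFn f x)
    have hw : Sat (treeStr D M) w (D.pre f) ↔ Sat (pointStr M (stateAfter D M (w.ind .sit 0)))
        (pointAsg x (M.actFn f x)) (D.pre f) := by
      rw [sat_congr_of_isFirstOrder (w := w') (D.pre_firstOrder f hf) fun p hp => ?_]
      · exact (sat_pointStr_iff (v' := w') (stateEq_point_tree D M _) (D.isCondition_pre hf)).symm
      · rcases D.pre_fv f hf hp with hp | rfl
        · exact (Asg.setInd_ind_of_ne w _ fun h => by
            have : p.1 = .act := congrArg Prod.fst h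
            simp [hp.1] at this).symm
        · rfl
    rw [hw]
    constructor
    · rintro ⟨g, y, hg, hxy, h⟩
      obtain rfl : f = g := by
        by_contra hfg
        exact ((models_una_iff D M).1 hM).2.1 f g hf hg hfg x y hxy
      obtain rfl : x = y := ((models_una_iff D M).1 hM).2.2 f hf hxy
      exact h
    · exact fun h => ⟨f, x, hf, rfl, h⟩
  · exact (models_una_iff D (treeStr D M)).2 ((models_una_iff D M).1 hM) φ hφ

/-- The initial theory is uniform in `S0`, and the root of the tree carries the initial state of
`M`. -/
theorem models_init_tree [Nonempty Obj] (D : BAT A)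
    {M : Str A Act Sit Obj} (hM : Models M D.init) : Models (treeStr D M) D.init := by
  intro φ hφ v'
  obtain ⟨v, hv⟩ := exists_asgRel (Sit := Sit) M.S0 ([] : List Act) v'
  exact ((stateEq_tree D M).sat_iff (S := .S0) (by simp [SitTerm.vars]) hv rfl rfl
    (D.init_uniform φ hφ)).1 (hM φ hφ v)

/-- A fluent-free sentence that follows from a progression follows from the initial theory. -/
theorem entails_of_progression {D : BAT A} {α : ActTerm A} (hα : α.vars = ∅) {P : Theory A}
    (hP : IsProgression.{u} D α P) {φ : Formula A} (hφ : FluentFree φ.sig)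
    (h : Entails.{u} (D.una ∪ replaceTheory P .S0 (sitAfter α)) φ) :
    Entails.{u} (D.una ∪ D.init) φ := by
  intro Act Sit Obj _ _ _ M hM v
  have huna : Models M D.una := fun ψ hψ => hM ψ (Or.inl hψ)
  have hinit : Models M D.init := fun ψ hψ => hM ψ (Or.inr hψ)
  have hback := models_background_tree D huna
  have hax : Models (treeStr D M) D.axioms := by
    rintro ψ (hψ | hψ)
    · exact hback ψ hψ
    · exact models_init_tree D hinit ψ hψ
  have hSα : (sitAfter α).vars = ∅ := by simp [sitAfter, SitTerm.vars, hα]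
  -- Groundness of `α` makes the situation after `α` independent of the assignment. Hence the tree
  -- is similar to itself and, as a model of all axioms, satisfies the progression.
  have heval : ∀ v w : Asg Act (List Act) Obj,
      (sitAfter α).eval (treeStr D M) v = (sitAfter α).eval (treeStr D M) w :=
    fun v w => SitTerm.eval_congr _ (by simp [hSα])
  have hprog := (hP.models_iff Act (List Act) Obj (treeStr D M)).2
    ⟨hback, _, _, hax, rfl, rfl, rfl, rfl, fun v v' F x => by rw [heval v v']⟩
  obtain ⟨v₀, -⟩ := exists_asgRel (Sit := List Act) [] M.S0 v
  set p := (sitAfter α).eval (treeStr D M) v₀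
  -- The situations of `M` are kept because `φ` may speak about them. Every situation gets the state
  -- at `p`, although only the one at `S0` is needed.
  let N : Str A Act Sit Obj := { M with fluent := fun F x _ => (treeStr D M).fluent F x p }
  have hN : StateEq (treeStr D M) N p N.S0 := ⟨rfl, rfl, rfl, rfl, fun _ _ => Iff.rfl⟩
  refine (sat_withFluent_iff M _ hφ v).1 (h Act Sit Obj N ?_ v)
  rintro ψ (hψ | ⟨ψ, hψ, rfl⟩)
  · exact (models_una_iff D N).2 ((models_una_iff D M).1 huna) ψ hψ
  · intro w
    obtain ⟨w', hw⟩ := exists_asgRel (Sit := List Act) p N.S0 w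
    -- Uniform sentences at `p` in the tree become, after replacement of the situation term,
    -- sentences at `S0` in `N`.
    exact (hN.sat_replace_iff (by simp [hSα]) (Set.empty_subset _) hw (heval _ _) rfl
      (hP.uniform ψ hψ)).1 (hprog ψ (Or.inr hψ) w')

end Tree

end SitCalc

/-! ### Inseparability of the components of the progression. -/

theorem mainTheorem2 (A : SitCalc.Alphabet)
    -- the logic: a set of second-order sentences with the parallel interpolation property
    (L : SitCalc.Theory A) (hL : ∀ φ ∈ L, φ.IsSentence) (hPIP : SitCalc.HasPIP.{u} L)
    -- the basic action theory
    (D : SitCalc.BAT A) (hinit : D.init ⊆ L) (huna : D.una ⊆ L)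
    -- the signatures
    (σ Δ : Set (SitCalc.Symbol A)) (hσ : σ ⊆ SitCalc.sig D.init) (hfree : SitCalc.FluentFree σ)
    (hΔ : Δ = SitCalc.sig D.una ∪ σ)
    -- the decomposition of the initial theory
    (I : Set ℕ) (C : I → SitCalc.Theory A)
    (hdec : SitCalc.IsDecomposition.{u} L σ D.init C)
    (hinf : I.Infinite → SitCalc.HasCountablePIP.{u} L)
    (hinsep : ∀ i k, SitCalc.Inseparable.{u} L Δ (D.una ∪ C i) (D.una ∪ C k))
    -- the progression and its components
    (α : SitCalc.ActTerm A) (hα : α.vars = ∅)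
    (P : SitCalc.Theory A) (hP : SitCalc.IsProgression.{u} D α P)
    (J : Set ℕ) (C' : J → SitCalc.Theory A) (hC'L : ∀ j, C' j ⊆ L)
    (hequiv : SitCalc.Equivalent.{u}
      (SitCalc.replaceTheory P .S0 (SitCalc.sitAfter α)) (⋃ j, C' j))
    (hcons : ∀ j, ∃ i,
      SitCalc.Cons.{u} L (D.una ∪ C i) Δ ⊆ SitCalc.Cons.{u} L (D.una ∪ C' j) Δ) :
    ∀ j k, SitCalc.Inseparable.{u} L Δ (D.una ∪ C' j) (D.una ∪ C' k) := by
  subst hΔ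
  -- This inclusion holds for every pair `i`, `j`, so it matches whichever `i` the assumed converse
  -- inclusion provides.
  have hle : ∀ i j, SitCalc.Cons.{u} L (D.una ∪ C' j) (SitCalc.sig D.una ∪ σ) ⊆
      SitCalc.Cons.{u} L (D.una ∪ C i) (SitCalc.sig D.una ∪ σ) := by
    rintro i j φ ⟨hφ, hent, hsig⟩
    have hff : SitCalc.FluentFree φ.sig := fun F hF =>
      (hsig hF).elim (SitCalc.fluentFree_sig_una D F) (hfree F)
    refine SitCalc.mem_cons_of_isDecomposition hPIP huna hdec hinf hinsep hφ hsig
      (SitCalc.entails_of_progression hα hP hff ?_) i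
    intro Act Sit Obj _ _ _ M hM
    refine hent Act Sit Obj M ?_
    rintro ψ (hψ | hψ)
    · exact hM ψ (Or.inl hψ)
    · exact (hequiv Act Sit Obj M).1 (fun χ hχ => hM χ (Or.inr hχ)) ψ (Set.mem_iUnion.2 ⟨j, hψ⟩)
  intro j k
  obtain ⟨i, hi⟩ := hcons j
  obtain ⟨i', hi'⟩ := hcons k
  have hj := (hle i j).antisymm hi
  have hk := (hle i' k).antisymm hi'
  exact hj.trans ((hinsep i i').trans hk.symm)
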